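/- For $z=(x,\omega)\in\mathbb{R}^2$ let $\pi(z)$ be the unitary operator on $L^2(\mathbb{R})$ given by $(\pi(x,\omega)f)(t)=e^{2\pi i t\omega}f(t-x)$. Let $\Lambda\subset\mathbb{R}^2$ be a (full-rank) lattice, let $$\Lambda^\circ=\{z\in\mathbb{R}^2 : \pi(\lambda)\pi(z)=\pi(z)\pi(\lambda)\ \text{for all } \lambda\in\Lambda\},$$ and let $B=\bigcap_{s\ge 0}\mathcal{A}^1_s(\Lambda^\circ)$ be the smooth noncommutative torus of $\Lambda^\circ$, where $\mathcal{A}^1_s(\Lambda^\circ)$ is the $*$-algebra of all bounded operators on $L^2(\mathbb{R})$ of the form $\sum_{z\in\Lambda^\circ}a(z)\pi(z)$ with $\sum_{z\in\Lambda^\circ}|a(z)|(1+|z|^2)^{s/2}<\infty$. For Schwartz functions $f,g\in\mathscr{S}(\mathbb{R})$ put $$\langle f,g\rangle_B=\sum_{z\in\Lambda^\circ}\langle \pi(z)g,f\rangle\,\pi(z)^*,$$ where $\langle u,v\rangle=\int_{\mathbb{R}}u(t)\overline{v(t)}\,dt$ and the sum is taken in the operator norm. **Theorem.** Let $g\in\mathscr{S}(\mathbb{R})$.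 Then the series defining $\langle g,g\rangle_B$ converges unconditionally in the operator norm and its sum belongs to $B$, and the Gabor system $\mathcal{G}(g,\Lambda)=\{\pi(\lambda)g : \lambda\in\Lambda\}$ is a frame for $L^2(\mathbb{R})$, that is, there are $\alpha,\beta>0$ with $$\alpha\|f\|_2^2\le\sum_{\lambda\in\Lambda}|\langle f,\pi(\lambda)g\rangle|^2\le\beta\|f\|_2^2\qquad\text{for all } f\in L^2(\mathbb{R}),$$ if and only if $\langle g,g\rangle_B$ is invertible in $B$. -/

import Mathlib

open MeasureTheory
open scoped SchwartzMap NNReal ENNReal InnerProductSpace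

noncomputable section

namespace GaborTorus

/-- The Hilbert space `L²(ℝ)` of complex valued functions. -/
abbrev L2R : Type := Lp ℂ 2 (volume : Measure ℝ)

/-- The character `e^{2π i r}`. -/
def expi (r : ℝ) : ℂ := Complex.exp (2 * Real.pi * Complex.I * r)

/-- The time-frequency shift of a function:
`(M_ω T_x f)(t) = e^{2π i t ω} f (t - x)` for `z = (x, ω)`. -/
def shiftFun (z : ℝ × ℝ) (f : ℝ → ℂ) : ℝ → ℂ :=
  fun t => expi (t * z.2) * f (t - z.1)

theorem expi_zero : expi 0 = 1 := by simp [expi]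

theorem expi_add (r s : ℝ) : expi (r + s) = expi r * expi s := by
  simp only [expi, Complex.ofReal_add, mul_add, Complex.exp_add]

theorem norm_expi (r : ℝ) : ‖expi r‖ = 1 := by
  rw [expi, show (2 * Real.pi * Complex.I * r : ℂ) = ((2 * Real.pi * r : ℝ) : ℂ) * Complex.I by
    push_cast; ring]
  exact Complex.norm_exp_ofReal_mul_I _

theorem expi_ne_zero (r : ℝ) : expi r ≠ 0 := Complex.exp_ne_zero _

theorem continuous_expi : Continuous expi := by
  unfold expi
  fun_prop

theorem memLp_shiftFun (z : ℝ × ℝ) {f : ℝ → ℂ} (hf : MemLp f 2 volume) :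
    MemLp (shiftFun z f) 2 volume := by
  have h1 : MemLp (fun t => f (t - z.1)) 2 volume :=
    hf.comp_measurePreserving (measurePreserving_sub_right volume z.1)
  refine (memLp_congr_norm ?_ h1.1 ?_).2 h1
  · exact ((continuous_expi.comp (continuous_id.mul continuous_const)).aestronglyMeasurable).mul
      h1.1
  · exact Filter.Eventually.of_forall fun t => by simp [shiftFun, norm_expi]

theorem eLpNorm_shiftFun (z : ℝ × ℝ) {f : ℝ → ℂ} (hf : MemLp f 2 volume) :
    eLpNorm (shiftFun z f) 2 volume = eLpNorm f 2 volume := by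
  have h2 : eLpNorm (shiftFun z f) 2 volume = eLpNorm (fun t => f (t - z.1)) 2 volume :=
    eLpNorm_congr_norm_ae (Filter.Eventually.of_forall fun t => by simp [shiftFun, norm_expi])
  rw [h2]
  exact eLpNorm_comp_measurePreserving hf.1 (measurePreserving_sub_right volume z.1)

theorem shiftFun_congr (z : ℝ × ℝ) {f g : ℝ → ℂ} (h : f =ᵐ[volume] g) :
    shiftFun z f =ᵐ[volume] shiftFun z g := by
  have h1 := (measurePreserving_sub_right (volume : Measure ℝ) z.1).quasiMeasurePreserving.ae_eq_comp h
  filter_upwards [h1] with t ht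
  simp only [Function.comp_apply] at ht
  simp only [shiftFun, ht]

/-- The time-frequency shift `π(x, ω) = M_ω T_x` as an isometry of `L²(ℝ)`. -/
def tfShiftIsom (z : ℝ × ℝ) : L2R →ₗᵢ[ℂ] L2R where
  toFun f := (memLp_shiftFun z (Lp.memLp f)).toLp
  map_add' f g := by
    rw [← MemLp.toLp_add, MemLp.toLp_eq_toLp_iff]
    filter_upwards [shiftFun_congr z (Lp.coeFn_add f g)] with t ht
    rw [ht]
    simp only [shiftFun, Pi.add_apply, mul_add]
  map_smul' c f := by
    rw [RingHom.id_apply, ← MemLp.toLp_const_smul, MemLp.toLp_eq_toLp_iff]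
    filter_upwards [shiftFun_congr z (Lp.coeFn_smul c f)] with t ht
    rw [ht]
    simp only [shiftFun, Pi.smul_apply, smul_eq_mul]
    ring
  norm_map' f := by
    change ‖(memLp_shiftFun z (Lp.memLp f)).toLp‖ = ‖f‖
    rw [Lp.norm_toLp, eLpNorm_shiftFun z (Lp.memLp f), Lp.norm_def]

/-- The time-frequency shift `π(x, ω) = M_ω T_x` as a bounded operator on `L²(ℝ)`. -/
def tfShift (z : ℝ × ℝ) : L2R →L[ℂ] L2R := (tfShiftIsom z).toContinuousLinearMap

theorem coeFn_tfShift (z : ℝ × ℝ) (f : L2R) : tfShift z f =ᵐ[volume] shiftFun z f :=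
  MemLp.coeFn_toLp (memLp_shiftFun z (Lp.memLp f))

theorem norm_tfShift_apply (z : ℝ × ℝ) (f : L2R) : ‖tfShift z f‖ = ‖f‖ :=
  (tfShiftIsom z).norm_map f

theorem norm_tfShift_le (z : ℝ × ℝ) : ‖tfShift z‖ ≤ 1 :=
  (tfShiftIsom z).norm_toContinuousLinearMap_le

theorem tfShift_zero : tfShift 0 = 1 := by
  ext1 f
  apply Lp.ext
  filter_upwards [coeFn_tfShift 0 f] with t ht
  rw [ht]
  simp [shiftFun, expi_zero]

/-- `π(z) π(w) = e^{-2π i x η} π(z + w)` for `z = (x, ω)`, `w = (y, η)`. -/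
theorem tfShift_mul (z w : ℝ × ℝ) :
    tfShift z * tfShift w = expi (-(z.1 * w.2)) • tfShift (z + w) := by
  ext1 f
  apply Lp.ext
  have h1 := coeFn_tfShift z (tfShift w f)
  have h2 := shiftFun_congr z (coeFn_tfShift w f)
  have h3 := coeFn_tfShift (z + w) f
  have h4 := Lp.coeFn_smul (expi (-(z.1 * w.2))) (tfShift (z + w) f)
  filter_upwards [h1, h2, h3, h4] with t h1 h2 h3 h4
  change (tfShift z (tfShift w f)) t = (expi (-(z.1 * w.2)) • tfShift (z + w) f) t
  rw [h1, h2, h4, Pi.smul_apply, h3]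
  simp only [shiftFun, smul_eq_mul, ← mul_assoc, ← expi_add, Prod.fst_add, Prod.snd_add]
  congr 2
  · ring
  · ring

theorem tfShift_neg_mul (z : ℝ × ℝ) :
    expi (-(z.1 * z.2)) • tfShift (-z) * tfShift z = 1 := by
  rw [smul_mul_assoc, tfShift_mul, smul_smul, ← expi_add, neg_add_cancel, tfShift_zero]
  simp [expi_zero]

theorem mul_tfShift_neg (z : ℝ × ℝ) :
    tfShift z * expi (-(z.1 * z.2)) • tfShift (-z) = 1 := by
  rw [mul_smul_comm, tfShift_mul, smul_smul, ← expi_add, add_neg_cancel, tfShift_zero]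
  simp [expi_zero]

theorem star_tfShift (z : ℝ × ℝ) :
    star (tfShift z) = expi (-(z.1 * z.2)) • tfShift (-z) := by
  have h : star (tfShift z) * tfShift z = 1 := by
    rw [ContinuousLinearMap.star_eq_adjoint]
    exact (ContinuousLinearMap.norm_map_iff_adjoint_comp_self _).1 (norm_tfShift_apply z)
  exact left_inv_eq_right_inv h (mul_tfShift_neg z)

/-- The dual lattice `Λ° = {z | π(λ) π(z) = π(z) π(λ) for all λ ∈ Λ}`. -/
def dualLattice (Λ : AddSubgroup (ℝ × ℝ)) : AddSubgroup (ℝ × ℝ) where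
  carrier := {z | ∀ l ∈ Λ, tfShift l * tfShift z = tfShift z * tfShift l}
  zero_mem' := fun l _ => by rw [tfShift_zero, mul_one, one_mul]
  add_mem' := by
    intro z w hz hw l hl
    have h : Commute (tfShift l) (tfShift z * tfShift w) :=
      Commute.mul_right (hz l hl) (hw l hl)
    have h2 : tfShift (z + w) = (expi (-(z.1 * w.2)))⁻¹ • (tfShift z * tfShift w) := by
      rw [tfShift_mul, smul_smul, inv_mul_cancel₀ (expi_ne_zero _), one_smul]
    rw [h2]
    exact h.smul_right _
  neg_mem' := by
    intro z hz l hl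
    have h : Commute (tfShift l) (tfShift z) := hz l hl
    let u : (L2R →L[ℂ] L2R)ˣ := ⟨tfShift z, _, mul_tfShift_neg z, tfShift_neg_mul z⟩
    have h1 : Commute (tfShift l) (expi (-(z.1 * z.2)) • tfShift (-z)) :=
      Commute.units_inv_right (u := u) h
    have h2 := h1.smul_right (expi (-(z.1 * z.2)))⁻¹
    rwa [smul_smul, inv_mul_cancel₀ (expi_ne_zero _), one_smul] at h2

/-- The polynomial weight `(1 + |z|²)^{s/2}`, with `|z|` the Euclidean norm on `ℝ²`. -/
def weight (s : ℝ≥0) (z : ℝ × ℝ) : ℝ := (1 + (z.1 ^ 2 + z.2 ^ 2)) ^ ((s : ℝ) / 2)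

theorem one_le_weight (s : ℝ≥0) (z : ℝ × ℝ) : 1 ≤ weight s z :=
  Real.one_le_rpow (by nlinarith [sq_nonneg z.1, sq_nonneg z.2]) (by positivity)

theorem weight_neg (s : ℝ≥0) (z : ℝ × ℝ) : weight s (-z) = weight s z := by
  simp [weight]

theorem weight_add_le (s : ℝ≥0) (z w : ℝ × ℝ) :
    weight s (z + w) ≤ 2 ^ ((s : ℝ) / 2) * (weight s z * weight s w) := by
  unfold weight
  rw [← Real.mul_rpow (by positivity) (by positivity),
    ← Real.mul_rpow (by positivity) (by positivity)]
  refine Real.rpow_le_rpow (by positivity) ?_ (by positivity)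
  simp only [Prod.fst_add, Prod.snd_add]
  nlinarith [sq_nonneg (z.1 - w.1), sq_nonneg (z.2 - w.2), sq_nonneg (z.1 * w.1),
    sq_nonneg (z.1 * w.2), sq_nonneg (z.2 * w.1), sq_nonneg (z.2 * w.2)]

/-- `T = ∑_{z ∈ Γ} a(z) π(z)` with `∑_{z ∈ Γ} |a(z)| (1 + |z|²)^{s/2} < ∞`. -/
def IsExpansion (s : ℝ≥0) (Γ : AddSubgroup (ℝ × ℝ)) (a : Γ → ℂ) (T : L2R →L[ℂ] L2R) : Prop :=
  Summable (fun z : Γ => ‖a z‖ * weight s z) ∧ HasSum (fun z : Γ => a z • tfShift z) T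

theorem IsExpansion.summable_norm {s : ℝ≥0} {Γ : AddSubgroup (ℝ × ℝ)} {a : Γ → ℂ}
    {T : L2R →L[ℂ] L2R} (h : IsExpansion s Γ a T) : Summable (fun z => ‖a z‖) :=
  h.1.of_nonneg_of_le (fun _ => norm_nonneg _)
    (fun z => le_mul_of_one_le_right (norm_nonneg _) (one_le_weight s z))

theorem isExpansion_smul_one (s : ℝ≥0) (Γ : AddSubgroup (ℝ × ℝ)) (c : ℂ) :
    ∃ a, IsExpansion s Γ a (c • (1 : L2R →L[ℂ] L2R)) := by
  classical
  refine ⟨Pi.single 0 c, ?_, ?_⟩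
  · refine summable_of_ne_finset_zero (s := {0}) fun z hz => ?_
    have : z ≠ 0 := by simpa using hz
    simp [this]
  · have h := hasSum_single (f := fun z : Γ => (Pi.single 0 c : Γ → ℂ) z • tfShift z) 0
      (fun z hz => by simp [hz])
    simpa [tfShift_zero] using h

theorem IsExpansion.add {s : ℝ≥0} {Γ : AddSubgroup (ℝ × ℝ)} {a b : Γ → ℂ}
    {T S : L2R →L[ℂ] L2R} (hT : IsExpansion s Γ a T) (hS : IsExpansion s Γ b S) :
    IsExpansion s Γ (a + b) (T + S) := by
  refine ⟨(hT.1.add hS.1).of_nonneg_of_le (fun z => ?_) (fun z => ?_), ?_⟩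
  · exact mul_nonneg (norm_nonneg _) (zero_le_one.trans (one_le_weight s z))
  · rw [← add_mul]
    exact mul_le_mul_of_nonneg_right (norm_add_le _ _) (zero_le_one.trans (one_le_weight s z))
  · simpa only [Pi.add_apply, add_smul] using hT.2.add hS.2

theorem IsExpansion.exists_star {s : ℝ≥0} {Γ : AddSubgroup (ℝ × ℝ)} {a : Γ → ℂ}
    {T : L2R →L[ℂ] L2R} (hT : IsExpansion s Γ a T) :
    ∃ b, IsExpansion s Γ b (star T) := by
  refine ⟨fun z => star (a (-z)) * expi (-((z : ℝ × ℝ).1 * (z : ℝ × ℝ).2)), ?_, ?_⟩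
  · have h := (Equiv.neg Γ).summable_iff.2 hT.1
    refine h.congr fun z => ?_
    simp [norm_expi, weight_neg]
  · have h := (Equiv.neg Γ).hasSum_iff.2 hT.2.star
    convert h using 2 with z
    simp [star_smul, star_tfShift, smul_smul]

theorem hasSum_mul_of_norm {ι κ R : Type*} [NormedRing R] [CompleteSpace R] {f : ι → R}
    {g : κ → R} {x y : R} (hf : HasSum f x) (hg : HasSum g y) (hf' : Summable fun i => ‖f i‖)
    (hg' : Summable fun i => ‖g i‖) : HasSum (fun p : ι × κ => f p.1 * g p.2) (x * y) :=
  hf.mul hg (summable_mul_of_summable_norm hf' hg')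

theorem hasSum_smul_fiber {ι κ E : Type*} [NormedAddCommGroup E] [NormedSpace ℂ E]
    {k : ι × κ → ℂ} {v : ι → E} {x : E} (hk : Summable k)
    (h : HasSum (fun p : ι × κ => k p • v p.1) x) :
    HasSum (fun u => (∑' w, k (u, w)) • v u) x :=
  h.prod_fiberwise fun u => (hk.prod_factor u).hasSum.smul_const (v u)

theorem IsExpansion.mul {s : ℝ≥0} {Γ : AddSubgroup (ℝ × ℝ)} {a b : Γ → ℂ}
    {T S : L2R →L[ℂ] L2R} (hT : IsExpansion s Γ a T) (hS : IsExpansion s Γ b S) :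
    ∃ d, IsExpansion s Γ d (T * S) := by
  let e : Γ × Γ ≃ Γ × Γ :=
    { toFun := fun p => (p.1 - p.2, p.2)
      invFun := fun p => (p.1 + p.2, p.2)
      left_inv := fun p => by simp
      right_inv := fun p => by simp }
  let k : Γ × Γ → ℂ := fun p =>
    a (p.1 - p.2) * b p.2 * expi (-(((p.1 - p.2 : Γ) : ℝ × ℝ).1 * (p.2 : ℝ × ℝ).2))
  have hk_norm : ∀ p, ‖k p‖ = ‖a (p.1 - p.2)‖ * ‖b p.2‖ := fun p => by simp [k, norm_expi]
  have hkw : Summable (fun p : Γ × Γ => ‖k p‖ * weight s p.1) := by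
    have h1 : Summable (fun p : Γ × Γ => (‖a p.1‖ * weight s p.1) * (‖b p.2‖ * weight s p.2)) :=
      hT.1.mul_of_nonneg hS.1
        (fun z => mul_nonneg (norm_nonneg _) (zero_le_one.trans (one_le_weight s z)))
        (fun z => mul_nonneg (norm_nonneg _) (zero_le_one.trans (one_le_weight s z)))
    have h2 := (e.summable_iff.2 h1).mul_left (2 ^ ((s : ℝ) / 2))
    refine h2.of_nonneg_of_le
      (fun p => mul_nonneg (norm_nonneg _) (zero_le_one.trans (one_le_weight s _))) (fun p => ?_)
    have h3 := weight_add_le s ((p.1 - p.2 : Γ) : ℝ × ℝ) (p.2 : ℝ × ℝ)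
    rw [← AddSubgroup.coe_add, sub_add_cancel] at h3
    rw [hk_norm]
    calc _ ≤ (‖a (p.1 - p.2)‖ * ‖b p.2‖) * _ := mul_le_mul_of_nonneg_left h3 (by positivity)
      _ = _ := by simp only [e, Function.comp_apply, Equiv.coe_fn_mk]; ring
  have hkn : Summable (fun p : Γ × Γ => ‖k p‖) :=
    hkw.of_nonneg_of_le (fun _ => norm_nonneg _)
      (fun p => le_mul_of_one_le_right (norm_nonneg _) (one_le_weight s _))
  have hk : Summable k := hkn.of_norm
  refine ⟨fun u => ∑' w, k (u, w), ?_, ?_⟩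
  · have h1 : Summable (fun u : Γ => ∑' w, ‖k (u, w)‖ * weight s u) := hkw.prod
    refine h1.of_nonneg_of_le
      (fun u => mul_nonneg (norm_nonneg _) (zero_le_one.trans (one_le_weight s _))) (fun u => ?_)
    rw [tsum_mul_right]
    exact mul_le_mul_of_nonneg_right (norm_tsum_le_tsum_norm (hkn.prod_factor u))
      (zero_le_one.trans (one_le_weight s _))
  · have hle : ∀ (c : Γ → ℂ), Summable (fun z => ‖c z‖) →
        Summable (fun z : Γ => ‖c z • tfShift (z : ℝ × ℝ)‖) := fun c hc =>
      hc.of_nonneg_of_le (fun _ => norm_nonneg _) (fun z => by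
        rw [norm_smul]
        exact mul_le_of_le_one_right (norm_nonneg _) (norm_tfShift_le _))
    have ha := hT.2
    have hb := hS.2
    have ha' := hle a hT.summable_norm
    have hb' := hle b hS.summable_norm
    have h1 := hasSum_mul_of_norm ha hb ha' hb'
    have h2 : HasSum (fun p : Γ × Γ => k p • tfShift (p.1 : ℝ × ℝ)) (T * S) := by
      refine (e.hasSum_iff.2 h1).congr_fun fun p => ?_
      have h3 : ((p.1 - p.2 : Γ) : ℝ × ℝ) + (p.2 : ℝ × ℝ) = (p.1 : ℝ × ℝ) := by
        rw [← AddSubgroup.coe_add, sub_add_cancel]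
      change k p • tfShift (p.1 : ℝ × ℝ) =
        (a (p.1 - p.2) • tfShift ((p.1 - p.2 : Γ) : ℝ × ℝ)) * (b p.2 • tfShift (p.2 : ℝ × ℝ))
      rw [smul_mul_smul_comm, tfShift_mul, smul_smul, h3]
    exact hasSum_smul_fiber hk h2

/-- The involutive algebra `𝒜¹_s(Γ)` of all operators `T = ∑_{z ∈ Γ} a(z) π(z)` on `L²(ℝ)` with
`∑_{z ∈ Γ} |a(z)| (1 + |z|²)^{s/2} < ∞`. -/
def weightedAlgebra (s : ℝ≥0) (Γ : AddSubgroup (ℝ × ℝ)) : StarSubalgebra ℂ (L2R →L[ℂ] L2R) where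
  carrier := {T | ∃ a, IsExpansion s Γ a T}
  mul_mem' := fun ⟨_, ha⟩ ⟨_, hb⟩ => ha.mul hb
  add_mem' := fun ⟨_, ha⟩ ⟨_, hb⟩ => ⟨_, ha.add hb⟩
  algebraMap_mem' := fun c => by
    rw [Algebra.algebraMap_eq_smul_one]
    exact isExpansion_smul_one s Γ c
  star_mem' := fun ⟨_, ha⟩ => ha.exists_star

/-- The smooth noncommutative torus `𝒜^∞(Γ) = ⋂_{s ≥ 0} 𝒜¹_s(Γ)`, as an algebra of operators.
Since `π(z)^*` is a unimodular multiple of `π(-z)`, expanding in the operators `π(z)^*` instead of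
`π(z)` gives the same operators. For `Γ = Λ°` this is the algebra `B`; it acts on Schwartz
functions from the right, so its product as a right acting algebra is the opposite of the
composition of operators, which does not affect invertibility. -/
def smoothTorus (Γ : AddSubgroup (ℝ × ℝ)) : StarSubalgebra ℂ (L2R →L[ℂ] L2R) :=
  ⨅ s : ℝ≥0, weightedAlgebra s Γ

/-- The class in `L²(ℝ)` of a Schwartz function. -/
def schwartzL2 (g : 𝓢(ℝ, ℂ)) : L2R := g.toLp 2 volume

/-- The Gabor system `{π(λ) g | λ ∈ Λ}` is a frame for `L²(ℝ)`: there are `α, β > 0` with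
`α ‖f‖² ≤ ∑_{λ ∈ Λ} |⟨f, π(λ) g⟩|² ≤ β ‖f‖²` for all `f ∈ L²(ℝ)`. -/
def IsGaborFrame (Λ : AddSubgroup (ℝ × ℝ)) (g : L2R) : Prop :=
  ∃ α > (0 : ℝ), ∃ β > (0 : ℝ), ∀ f : L2R,
    Summable (fun l : Λ => ‖⟪tfShift l g, f⟫_ℂ‖ ^ 2) ∧
    α * ‖f‖ ^ 2 ≤ ∑' l : Λ, ‖⟪tfShift l g, f⟫_ℂ‖ ^ 2 ∧
    ∑' l : Λ, ‖⟪tfShift l g, f⟫_ℂ‖ ^ 2 ≤ β * ‖f‖ ^ 2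

/-- The terms `⟨π(z) g, f⟩ π(z)^*`, `z ∈ Λ°`, of the `B`-valued inner product. The `L²` inner
product that is linear in its first variable, `⟨u, v⟩ = ∫ u(t) conj(v(t)) dt`, is `⟪v, u⟫_ℂ`. -/
def innerBTerm (Λ : AddSubgroup (ℝ × ℝ)) (f g : 𝓢(ℝ, ℂ)) (z : dualLattice Λ) :
    L2R →L[ℂ] L2R :=
  ⟪schwartzL2 f, tfShift z (schwartzL2 g)⟫_ℂ • star (tfShift z)

/-- The `B`-valued inner product `⟨f, g⟩_B = ∑_{z ∈ Λ°} ⟨π(z) g, f⟩ π(z)^*`, the sum being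
taken in the operator norm. -/
def innerB (Λ : AddSubgroup (ℝ × ℝ)) (f g : 𝓢(ℝ, ℂ)) : L2R →L[ℂ] L2R :=
  ∑' z : dualLattice Λ, innerBTerm Λ f g z

end GaborTorus

end

/-! Write T for ⟨g,g⟩_B. Both conditions are compared with a third one: T is invertible among all
bounded operators on L²(ℝ).

Frame versus invertibility (Janssen's representation). The function |V_g f|² on the time-frequency
plane, V_g f being the short-time Fourier transform, has a symplectic Fourier transform that the
orthogonality relations evaluate as a product of two inner products (`integral_expi_mul_stft`).
Poisson summation over Λ, whose symplectic dual is Λ°, therefore gives Σ_λ |⟨f, π(λ)g⟩|² = c⟨Tf, f⟩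
with a constant c > 0, for Schwartz f and then by density for all f (`exists_hasSum_norm_inner_sq`).
Since T is bounded, the upper frame bound is automatic; since T is positive and self-adjoint, the
lower one is equivalent to invertibility of T.

Invertibility in B(L²) versus in B (`inverse_mem_smoothTorus`). A functional φ on B(L²) that is
invariant under conjugation by all shifts assigns to any bounded Y the coefficients φ(π(z)^*Y). If T
lies in 𝒜¹_n, the differences of order j ≤ n of w ↦ π(w)Tπ(w)^* are O(|w|^j), and the quotient rule
transfers this to T⁻¹. At the coefficient of index z ≠ 0, a vector w of length 1/(2|z|) makes the
order-n difference act as multiplication by (-2)^n, so this coefficient is O(|z|^{-n}). The series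
with these coefficients over Λ° then lies in B, and it is a right inverse of T, hence equal to T⁻¹.
-/

noncomputable section

namespace GaborTorus

/-! ### Invariant means for commuting contractions -/

section InvariantFunctional

variable {E : Type*} [NormedAddCommGroup E] [NormedSpace ℂ E]

/-- A commuting family of contractions fixing a unit vector `e` admits an invariant continuous
linear functional which is `1` at `e`. -/
theorem exists_invariant_functional {ι : Type*} (α : ι → E →L[ℂ] E) (e : E) (hne : ‖e‖ = 1)
    (hc : ∀ i j, Commute (α i) (α j)) (hα : ∀ i x, ‖α i x‖ ≤ ‖x‖) (he : ∀ i, α i e = e) :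
    ∃ φ : E →L[ℂ] ℂ, φ e = 1 ∧ ∀ i x, φ (α i x) = φ x := by
  let 𝒜 : Subalgebra ℂ (E →L[ℂ] E) := Algebra.adjoin ℂ (Set.range α)
  have hcomm : ∀ A ∈ 𝒜, ∀ B ∈ 𝒜, Commute A B := by
    intro A hA B hB
    refine Algebra.commute_of_mem_adjoin_of_forall_mem_commute hB ?_
    rintro _ ⟨j, rfl⟩
    refine (Algebra.commute_of_mem_adjoin_of_forall_mem_commute hA ?_).symm
    rintro _ ⟨i, rfl⟩
    exact hc j i
  let M : Set (E →L[ℂ] E) := {A | A ∈ 𝒜 ∧ (∀ x, ‖A x‖ ≤ ‖x‖) ∧ A e = e}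
  -- V is the space to be annihilated: it contains every `α i x - x`, yet stays at distance at least
  -- 1 from `e`.
  let V : Submodule ℂ E :=
    { carrier := {x | ∀ ε > 0, ∃ A ∈ M, ‖A x‖ < ε}
      zero_mem' := fun ε hε => ⟨1, ⟨𝒜.one_mem, fun x => le_rfl, rfl⟩, by simpa using hε⟩
      add_mem' := by
        intro x y hx hy ε hε
        obtain ⟨A, hA, hAx⟩ := hx (ε / 2) (half_pos hε)
        obtain ⟨B, hB, hBy⟩ := hy (ε / 2) (half_pos hε)
        -- A shrinks x and B shrinks y; as they commute and contract, the product shrinks both.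
        refine ⟨A * B, ⟨𝒜.mul_mem hA.1 hB.1, fun z => (hA.2.1 _).trans (hB.2.1 _), ?_⟩, ?_⟩
        · rw [mul_apply_eq_comp, hB.2.2, hA.2.2]
        · have h1 : (A * B) (x + y) = B (A x) + A (B y) := by
            have h2 : (A * B) x = (B * A) x := by rw [(hcomm A hA.1 B hB.1).eq]
            rw [map_add, h2]
            rfl
          rw [h1]
          calc _ ≤ ‖B (A x)‖ + ‖A (B y)‖ := norm_add_le _ _
            _ ≤ ‖A x‖ + ‖B y‖ := add_le_add (hB.2.1 _) (hA.2.1 _)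
            _ < ε := by linarith
      smul_mem' := by
        intro c x hx ε hε
        obtain ⟨A, hA, hAx⟩ := hx (ε / (‖c‖ + 1)) (by positivity)
        refine ⟨A, hA, ?_⟩
        rw [map_smul, norm_smul]
        rw [lt_div_iff₀ (by positivity)] at hAx
        nlinarith [norm_nonneg (A x), norm_nonneg c] }
  have hV1 : ∀ x ∈ V, 1 ≤ ‖e - x‖ := by
    intro x hx
    refine le_of_forall_pos_le_add fun ε hε => ?_
    obtain ⟨A, hA, hAx⟩ := hx ε hε
    have h1 : ‖e - A x‖ ≤ ‖e - x‖ := by simpa [hA.2.2] using hA.2.1 (e - x)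
    have h2 := norm_sub_norm_le e (A x)
    linarith
  have hV2 : ∀ i x, α i x - x ∈ V := by
    intro i x ε hε
    obtain ⟨n, hn⟩ := exists_nat_gt (2 * ‖x‖ / ε)
    have hn0 : 0 < (n : ℝ) := lt_of_le_of_lt (by positivity) hn
    have hpow : ∀ k y, ‖(α i ^ k) y‖ ≤ ‖y‖ := by
      intro k y
      induction k with
      | zero => simp
      | succ k ih => rw [pow_succ', mul_apply_eq_comp]; exact (hα i _).trans ih
    have hpe : ∀ k, (α i ^ k) e = e := by
      intro k
      induction k with
      | zero => simp
      | succ k ih => rw [pow_succ', mul_apply_eq_comp, ih, he]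
    -- Cesàro mean of the powers of `α i`: on `α i x - x` the sum telescopes, leaving at most
    -- 2‖x‖/n.
    refine ⟨((n : ℂ)⁻¹) • ∑ k ∈ Finset.range n, α i ^ k, ⟨?_, fun y => ?_, ?_⟩, ?_⟩
    · exact 𝒜.smul_mem (sum_mem fun k _ =>
        𝒜.pow_mem (Algebra.subset_adjoin ⟨i, rfl⟩) k) _
    · rw [smul_apply, sum_apply, norm_smul, norm_inv,
        Complex.norm_natCast]
      have : ‖∑ k ∈ Finset.range n, (α i ^ k) y‖ ≤ n * ‖y‖ := by
        refine (norm_sum_le_of_le _ fun k _ => hpow k y).trans ?_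
        simp
      rw [inv_mul_le_iff₀ hn0]
      exact this
    · rw [smul_apply, sum_apply]
      simp only [hpe, Finset.sum_const, Finset.card_range]
      rw [← Nat.cast_smul_eq_nsmul ℂ, smul_smul, inv_mul_cancel₀, one_smul]
      exact_mod_cast hn0.ne'
    · have h1 : (∑ k ∈ Finset.range n, α i ^ k) (α i x - x) = (α i ^ n) x - x := by
        have := congrArg (fun A : E →L[ℂ] E => A x) (geom_sum_mul (α i) n)
        simpa using this
      rw [smul_apply, h1, norm_smul, norm_inv, Complex.norm_natCast,
        inv_mul_lt_iff₀ hn0]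
      have h2 : ‖(α i ^ n) x - x‖ ≤ 2 * ‖x‖ := by
        have := norm_sub_le ((α i ^ n) x) x
        linarith [hpow n x]
      rw [div_lt_iff₀ hε] at hn
      linarith
  let W : Submodule ℂ E := V.topologicalClosure
  have hWc : IsClosed (W : Set E) := V.isClosed_topologicalClosure
  have heW : e ∉ W := by
    intro h
    obtain ⟨x, hx, hxe⟩ := Metric.mem_closure_iff.1 (show e ∈ closure (V : Set E) from h) 1 one_pos
    rw [dist_eq_norm] at hxe
    exact absurd (hV1 x hx) (not_le.2 hxe)
  have : IsClosed (W : Set E) := hWc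
  have hq : ‖(W.mkQ e : E ⧸ W)‖ ≠ 0 := by
    rw [norm_ne_zero_iff]
    simpa using heW
  -- Hahn–Banach in the quotient by the closure of V; rescaling makes the value at `e` equal to 1.
  obtain ⟨ψ, -, hψ⟩ := exists_dual_vector ℂ (W.mkQ e : E ⧸ W) hq
  have hψ0 : ψ (W.mkQ e) ≠ 0 := by rw [hψ]; exact Complex.ofReal_ne_zero.2 hq
  refine ⟨(ψ (W.mkQ e))⁻¹ • ψ.comp W.mkQL, ?_, fun i x => ?_⟩
  · simpa using inv_mul_cancel₀ hψ0
  · have h1 : W.mkQ (α i x) = W.mkQ x := by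
      rw [← sub_eq_zero, ← map_sub]
      exact (Submodule.Quotient.mk_eq_zero W).2 (V.le_topologicalClosure (hV2 i x))
    have h2 : W.mkQL (α i x) = W.mkQL x := h1
    simp [h2]

end InvariantFunctional

/-! ### Iterated differences of products and inverses -/

section Differences

variable {R : Type*} [NormedRing R] [NormedAlgebra ℂ R]

/-- Iterate the twisted Leibniz rule (α-1)(xy) = (α-1)x · αy + x · (α-1)y. Each difference doubles
the number of terms, whence 2^j; the twist is harmless because α contracts and commutes with its own
differences. -/
theorem norm_sub_one_pow_mul_le {α : R →L[ℂ] R} (hm : ∀ x y, α (x * y) = α x * α y)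
    (hα : ∀ x, ‖α x‖ ≤ ‖x‖) {r : ℝ} (hr : 0 ≤ r) (n : ℕ) :
    ∀ (x y : R) (A B : ℝ), 0 ≤ A → 0 ≤ B → (∀ j ≤ n, ‖((α - 1) ^ j) x‖ ≤ A * r ^ j) →
      (∀ j ≤ n, ‖((α - 1) ^ j) y‖ ≤ B * r ^ j) →
      ∀ j ≤ n, ‖((α - 1) ^ j) (x * y)‖ ≤ 2 ^ j * (A * B) * r ^ j := by
  have h0 : ∀ (x y : R) (A B : ℝ), 0 ≤ A → ‖x‖ ≤ A → ‖y‖ ≤ B → ‖x * y‖ ≤ A * B :=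
    fun x y A B hA hx hy => (norm_mul_le x y).trans
      (mul_le_mul hx hy (norm_nonneg _) hA)
  induction n with
  | zero =>
    intro x y A B hA hB hx hy j hj
    obtain rfl : j = 0 := by omega
    simpa using h0 x y A B hA (by simpa using hx 0 le_rfl) (by simpa using hy 0 le_rfl)
  | succ n ih =>
    intro x y A B hA hB hx hy j hj
    rcases j with _ | j
    · simpa using h0 x y A B hA (by simpa using hx 0 (by omega)) (by simpa using hy 0 (by omega))
    have hcomm : Commute α ((α - 1) ^ j) :=
      ((Commute.refl α).sub_right (Commute.one_right α)).pow_right j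
    have hd : (α - 1) (x * y) = (α - 1) x * α y + x * (α - 1) y := by
      simp only [sub_apply, one_apply_eq_self, hm]
      noncomm_ring
    have hdx : ∀ (z : R) (D : ℝ), (∀ j ≤ n + 1, ‖((α - 1) ^ j) z‖ ≤ D * r ^ j) →
        ∀ j ≤ n, ‖((α - 1) ^ j) ((α - 1) z)‖ ≤ (D * r) * r ^ j := by
      intro z D hz j hj
      have := hz (j + 1) (by omega)
      rw [pow_succ, mul_apply_eq_comp] at this
      calc _ ≤ _ := this
        _ = _ := by ring
    have hay : ∀ j ≤ n, ‖((α - 1) ^ j) (α y)‖ ≤ B * r ^ j := by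
      intro j hj
      have hcomm : Commute α ((α - 1) ^ j) :=
        ((Commute.refl α).sub_right (Commute.one_right α)).pow_right j
      rw [← mul_apply_eq_comp, ← hcomm.eq, mul_apply_eq_comp]
      exact (hα _).trans (hy j (by omega))
    rw [pow_succ, mul_apply_eq_comp, hd, map_add]
    have h1 := ih ((α - 1) x) (α y) (A * r) B (by positivity) hB (hdx x A hx) hay j (by omega)
    have h2 := ih x ((α - 1) y) A (B * r) hA (by positivity) (fun j hj => hx j (by omega))
      (hdx y B hy) j (by omega)
    calc _ ≤ _ := norm_add_le _ _
      _ ≤ _ := add_le_add h1 h2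
      _ = _ := by ring

/-- The iterated differences of an inverse are bounded by those of the element. -/
theorem exists_norm_sub_one_pow_inverse_le (n : ℕ) (A K : ℝ) (hA : 0 ≤ A) (hK : 0 ≤ K) :
    ∃ C : ℝ, 0 ≤ C ∧ ∀ (α : R →L[ℂ] R), (∀ x y, α (x * y) = α x * α y) → (∀ x, ‖α x‖ ≤ ‖x‖) →
      α 1 = 1 → ∀ (r : ℝ), 0 ≤ r → ∀ x y : R, x * y = 1 → y * x = 1 → ‖y‖ ≤ K →
      (∀ j ≤ n, ‖((α - 1) ^ j) x‖ ≤ A * r ^ j) → ∀ j ≤ n, ‖((α - 1) ^ j) y‖ ≤ C * r ^ j := by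
  induction n with
  | zero =>
    refine ⟨K, hK, fun α _ _ _ r _ x y _ _ hy _ j hj => ?_⟩
    obtain rfl : j = 0 := by omega
    simpa using hy
  | succ n ih =>
    obtain ⟨C, hC, h⟩ := ih
    -- Order n + 1 uses the product rule twice, each time with a factor 2^n, on three factors
    -- bounded through C, A and C. The summand C keeps the lower orders covered. Nothing here
    -- depends on α or r.
    refine ⟨C + 4 ^ n * (C * A * C), by positivity, fun α hm hα h1 r hr x y hxy hyx hy hx j hj => ?_⟩
    have hyC := h α hm hα h1 r hr x y hxy hyx hy (fun j hj => hx j (by omega))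
    rcases Nat.lt_or_ge n j with hjn | hjn
    · obtain rfl : j = n + 1 := by omega
      have hay : ∀ j ≤ n, ‖((α - 1) ^ j) (α y)‖ ≤ C * r ^ j := by
        intro j hj
        have hcomm : Commute α ((α - 1) ^ j) :=
          ((Commute.refl α).sub_right (Commute.one_right α)).pow_right j
        rw [← mul_apply_eq_comp, ← hcomm.eq, mul_apply_eq_comp]
        exact (hα _).trans (hyC j (by omega))
      have hdx : ∀ j ≤ n, ‖((α - 1) ^ j) ((α - 1) x)‖ ≤ (A * r) * r ^ j := by
        intro j hj
        have := hx (j + 1) (by omega)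
        rw [pow_succ, mul_apply_eq_comp] at this
        calc _ ≤ _ := this
          _ = _ := by ring
      have h2 := norm_sub_one_pow_mul_le hm hα hr n (α y) ((α - 1) x) C (A * r) hC (by positivity)
        hay hdx
      have h2' : ∀ j ≤ n, ‖((α - 1) ^ j) (α y * (α - 1) x)‖ ≤ (2 ^ n * (C * (A * r))) * r ^ j := by
        intro j hj
        refine (h2 j hj).trans ?_
        gcongr
        exact one_le_two
      have h3 := norm_sub_one_pow_mul_le hm hα hr n _ y _ C (by positivity) hC h2' hyC n le_rfl
      -- Quotient rule: one difference falls on x, so only differences of y of order at most n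
      -- remain.
      have hd : (α - 1) y = -(α y * (α - 1) x * y) := by
        have h4 : α y * α x = 1 := by rw [← hm, hyx, h1]
        simp only [sub_apply, one_apply_eq_self]
        rw [mul_sub, sub_mul, h4, mul_assoc, hxy]
        noncomm_ring
      rw [pow_succ, mul_apply_eq_comp, hd, map_neg, norm_neg]
      calc _ ≤ _ := h3
        _ = 4 ^ n * (C * A * C) * r ^ (n + 1) := by
          rw [show (4 : ℝ) = 2 * 2 by norm_num, mul_pow]; ring
        _ ≤ _ := by
          rw [add_mul]
          exact le_add_of_nonneg_left (by positivity)
    · refine (hyC j hjn).trans ?_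
      gcongr
      exact le_add_of_nonneg_right (by positivity)

end Differences

/-! ### Commutation of time-frequency shifts and conjugation by them -/

theorem expi_neg (r : ℝ) : expi (-r) = (expi r)⁻¹ := by
  refine eq_inv_of_mul_eq_one_left ?_
  rw [← expi_add, neg_add_cancel, expi_zero]

theorem star_expi (r : ℝ) : star (expi r) = expi (-r) := by
  rw [expi_neg]
  exact (Complex.inv_eq_conj (norm_expi r)).symm

theorem expi_half : expi (1 / 2) = -1 := by
  rw [expi, show (2 * Real.pi * Complex.I * ((1 / 2 : ℝ) : ℂ)) = Real.pi * Complex.I by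
    push_cast; ring, Complex.exp_pi_mul_I]

theorem norm_expi_sub_one_le (r : ℝ) : ‖expi r - 1‖ ≤ 2 * Real.pi * |r| := by
  have h := Real.norm_exp_I_mul_ofReal_sub_one_le (x := 2 * Real.pi * r)
  rw [expi, show (2 * Real.pi * Complex.I * r : ℂ) = Complex.I * ((2 * Real.pi * r : ℝ) : ℂ) by
    push_cast; ring]
  refine h.trans_eq ?_
  rw [Real.norm_eq_abs, abs_mul, abs_of_pos Real.two_pi_pos]

/-- The symplectic form on the time-frequency plane. -/
def sympl (w z : ℝ × ℝ) : ℝ := z.1 * w.2 - w.1 * z.2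

theorem star_tfShift_mul_self (z : ℝ × ℝ) : star (tfShift z) * tfShift z = 1 := by
  rw [star_tfShift, tfShift_neg_mul]

theorem tfShift_mul_star_self (z : ℝ × ℝ) : tfShift z * star (tfShift z) = 1 := by
  rw [star_tfShift, mul_tfShift_neg]

theorem tfShift_mul_comm (w z : ℝ × ℝ) :
    tfShift w * tfShift z = expi (sympl w z) • (tfShift z * tfShift w) := by
  rw [tfShift_mul, tfShift_mul, smul_smul, ← expi_add, add_comm z w, sympl]
  congr 2
  ring

instance : Nontrivial L2R := by
  let f : L2R := indicatorConstLp 2 (measurableSet_Icc (a := (0 : ℝ)) (b := 1))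
    (by simp) (1 : ℂ)
  refine ⟨f, 0, ?_⟩
  rw [← norm_ne_zero_iff, norm_indicatorConstLp (by simp) (by simp)]
  simp

theorem norm_star_tfShift_le (z : ℝ × ℝ) : ‖star (tfShift z)‖ ≤ 1 := by
  rw [ContinuousLinearMap.star_eq_adjoint, LinearIsometryEquiv.norm_map]
  exact norm_tfShift_le z

theorem tfShift_ne_zero (z : ℝ × ℝ) : tfShift z ≠ 0 := by
  intro h
  have h1 := star_tfShift_mul_self z
  rw [h, mul_zero] at h1
  exact zero_ne_one h1

theorem mem_dualLattice_iff {Λ : AddSubgroup (ℝ × ℝ)} {z : ℝ × ℝ} :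
    z ∈ dualLattice Λ ↔ ∀ l ∈ Λ, expi (sympl l z) = 1 := by
  refine forall₂_congr fun l _ => ?_
  rw [tfShift_mul_comm l z, tfShift_mul, smul_smul]
  constructor
  · intro h
    have h1 := smul_left_injective ℂ (tfShift_ne_zero (z + l)) h
    exact (mul_eq_right₀ (expi_ne_zero _)).1 h1
  · intro h
    rw [h, one_mul]

/-- Conjugation `X ↦ π(w) X π(w)^*`. -/
def conjShift (w : ℝ × ℝ) : (L2R →L[ℂ] L2R) →L[ℂ] (L2R →L[ℂ] L2R) :=
  ContinuousLinearMap.mulLeftRight ℂ _ (tfShift w) (star (tfShift w))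

theorem conjShift_apply (w : ℝ × ℝ) (X : L2R →L[ℂ] L2R) :
    conjShift w X = tfShift w * X * star (tfShift w) := rfl

theorem conjShift_mul (w : ℝ × ℝ) (X Y : L2R →L[ℂ] L2R) :
    conjShift w (X * Y) = conjShift w X * conjShift w Y := by
  simp only [conjShift_apply]
  calc _ = tfShift w * X * 1 * Y * star (tfShift w) := by noncomm_ring
    _ = _ := by rw [← star_tfShift_mul_self w]; noncomm_ring

theorem conjShift_one (w : ℝ × ℝ) : conjShift w 1 = 1 := by
  rw [conjShift_apply, mul_one, tfShift_mul_star_self]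

theorem norm_conjShift_apply_le (w : ℝ × ℝ) (X : L2R →L[ℂ] L2R) : ‖conjShift w X‖ ≤ ‖X‖ := by
  rw [conjShift_apply]
  calc _ ≤ ‖tfShift w‖ * ‖X‖ * ‖star (tfShift w)‖ := norm_mul₃_le
    _ ≤ 1 * ‖X‖ * 1 := by
      gcongr
      · exact norm_tfShift_le w
      · exact norm_star_tfShift_le w
    _ = _ := by ring

/-- The shifts commute only up to a phase, but conjugation meets this phase once with each sign. -/
theorem conjShift_comm (w v : ℝ × ℝ) : Commute (conjShift w) (conjShift v) := by
  refine ContinuousLinearMap.ext fun X => ?_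
  change tfShift w * (tfShift v * X * star (tfShift v)) * star (tfShift w)
    = tfShift v * (tfShift w * X * star (tfShift w)) * star (tfShift v)
  have h2 : star (tfShift v) * star (tfShift w) =
      expi (-sympl w v) • (star (tfShift w) * star (tfShift v)) := by
    rw [← star_mul, tfShift_mul_comm, star_smul, star_expi, star_mul]
  calc _ = (tfShift w * tfShift v) * X * (star (tfShift v) * star (tfShift w)) := by noncomm_ring
    _ = (tfShift v * tfShift w) * X * (star (tfShift w) * star (tfShift v)) := by
      rw [h2, tfShift_mul_comm w v, smul_mul_assoc, smul_mul_assoc, mul_smul_comm, smul_smul,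
        ← expi_add, add_neg_cancel, expi_zero, one_smul]
    _ = _ := by noncomm_ring

theorem conjShift_tfShift (w z : ℝ × ℝ) :
    conjShift w (tfShift z) = expi (sympl w z) • tfShift z := by
  rw [conjShift_apply, tfShift_mul_comm, smul_mul_assoc, mul_assoc, tfShift_mul_star_self, mul_one]

theorem conjShift_star_tfShift (w z : ℝ × ℝ) :
    conjShift w (star (tfShift z)) = expi (-sympl w z) • star (tfShift z) := by
  have h : conjShift w (star (tfShift z)) = star (conjShift w (tfShift z)) := by
    simp [conjShift_apply, mul_assoc]
  rw [h, conjShift_tfShift, star_smul, star_expi]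

theorem sub_one_pow_tfShift (w z : ℝ × ℝ) (j : ℕ) :
    ((conjShift w - 1) ^ j) (tfShift z) = (expi (sympl w z) - 1) ^ j • tfShift z := by
  induction j with
  | zero => simp
  | succ j ih =>
    rw [pow_succ', mul_apply_eq_comp, ih, map_smul, sub_apply, one_apply_eq_self,
      conjShift_tfShift, pow_succ, mul_smul, sub_smul, one_smul]

/-- There is a state on `B(L²)` invariant under all conjugations by time-frequency shifts. -/
theorem exists_invariant_state : ∃ φ : (L2R →L[ℂ] L2R) →L[ℂ] ℂ, φ 1 = 1 ∧
    ∀ w X, φ (conjShift w X) = φ X :=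
  exists_invariant_functional conjShift 1 norm_one conjShift_comm norm_conjShift_apply_le
    conjShift_one

/-! ### Fourier coefficients of bounded operators -/

section Coefficients

variable {φ : (L2R →L[ℂ] L2R) →L[ℂ] ℂ}

/-- Take z turned by a right angle and divided by 2|z|². The phase at such w is -1, the value
farthest from 1, and |w| is inversely proportional to |z|; this converts smallness in w into decay
in z. -/
theorem exists_sympl_eq_half {z : ℝ × ℝ} (hz : z ≠ 0) :
    ∃ w : ℝ × ℝ, sympl w z = 1 / 2 ∧
      √(w.1 ^ 2 + w.2 ^ 2) = (2 * √(z.1 ^ 2 + z.2 ^ 2))⁻¹ := by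
  have hpos : 0 < z.1 ^ 2 + z.2 ^ 2 := by
    have : z.1 ≠ 0 ∨ z.2 ≠ 0 := by
      by_contra! h
      exact hz (Prod.ext h.1 h.2)
    rcases this with h | h <;> positivity
  refine ⟨(-z.2 / (2 * (z.1 ^ 2 + z.2 ^ 2)), z.1 / (2 * (z.1 ^ 2 + z.2 ^ 2))), ?_, ?_⟩
  · simp only [sympl]
    field_simp
    ring
  · rw [Real.sqrt_eq_iff_mul_self_eq (by positivity) (by positivity), ← mul_inv,
      show 2 * √(z.1 ^ 2 + z.2 ^ 2) * (2 * √(z.1 ^ 2 + z.2 ^ 2)) =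
        4 * (√(z.1 ^ 2 + z.2 ^ 2) * √(z.1 ^ 2 + z.2 ^ 2)) by ring,
      Real.mul_self_sqrt hpos.le]
    field_simp
    ring

theorem abs_sympl_le (w z : ℝ × ℝ) :
    |sympl w z| ≤ √(w.1 ^ 2 + w.2 ^ 2) * √(z.1 ^ 2 + z.2 ^ 2) := by
  rw [← Real.sqrt_mul (by positivity)]
  apply Real.abs_le_sqrt
  simp only [sympl]
  nlinarith [sq_nonneg (z.1 * w.1 + z.2 * w.2)]

/-- For z ≠ 0, conjugation by a suitable shift changes the sign of π(z), so invariance forces the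
value 0. -/
theorem state_tfShift (h1 : φ 1 = 1) (hφ : ∀ w X, φ (conjShift w X) = φ X) (z : ℝ × ℝ) :
    φ (tfShift z) = if z = 0 then 1 else 0 := by
  split_ifs with hz
  · rw [hz, tfShift_zero, h1]
  · obtain ⟨w, hw, -⟩ := exists_sympl_eq_half hz
    have h := hφ w (tfShift z)
    rw [conjShift_tfShift, map_smul, hw, expi_half, smul_eq_mul, neg_one_mul] at h
    exact self_eq_neg.1 h.symm

theorem state_star_tfShift_mul_tfShift (h1 : φ 1 = 1) (hφ : ∀ w X, φ (conjShift w X) = φ X)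
    (z u : ℝ × ℝ) :
    φ (star (tfShift z) * tfShift u) = if u = z then 1 else 0 := by
  split_ifs with h
  · rw [h, star_tfShift_mul_self, h1]
  · rw [star_tfShift, smul_mul_assoc, tfShift_mul, map_smul, map_smul, state_tfShift h1 hφ,
      if_neg]
    · simp
    · intro h2
      exact h (neg_add_eq_zero.1 h2).symm

/-- The shifts are orthonormal for (S, T) ↦ φ(S^*T), and φ may be applied to the series term by
term. In particular the coefficients determine an operator known to have an expansion. -/
theorem IsExpansion.state_eq {s : ℝ≥0} {Γ : AddSubgroup (ℝ × ℝ)} {a : Γ → ℂ}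
    {T : L2R →L[ℂ] L2R} (h : IsExpansion s Γ a T) (h1 : φ 1 = 1)
    (hφ : ∀ w X, φ (conjShift w X) = φ X) (z : Γ) : φ (star (tfShift z) * T) = a z := by
  have h2 := (h.2.mul_left (star (tfShift z))).mapL φ
  have h3 := hasSum_single (f := fun u : Γ => φ (star (tfShift z) * a u • tfShift u)) z
    (fun u hu => by
      rw [mul_smul_comm, map_smul, state_star_tfShift_mul_tfShift h1 hφ, if_neg, smul_zero]
      exact fun h => hu (Subtype.ext h))
  rw [h2.unique h3, mul_smul_comm, map_smul, state_star_tfShift_mul_tfShift h1 hφ, if_pos rfl,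
    smul_eq_mul, mul_one]

/-- On coefficients, differences act as multipliers. This uses invariance of φ only, so it applies
to an inverse before any expansion of it is known. -/
theorem state_sub_one_pow (hφ : ∀ w X, φ (conjShift w X) = φ X) (w z : ℝ × ℝ)
    (j : ℕ) (Y : L2R →L[ℂ] L2R) :
    φ (star (tfShift z) * ((conjShift w - 1) ^ j) Y) =
      (expi (sympl w z) - 1) ^ j * φ (star (tfShift z) * Y) := by
  have hstep : ∀ X : L2R →L[ℂ] L2R, φ (star (tfShift z) * (conjShift w - 1) X) =
      (expi (sympl w z) - 1) * φ (star (tfShift z) * X) := by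
    intro X
    have h : star (tfShift z) = expi (sympl w z) • conjShift w (star (tfShift z)) := by
      rw [conjShift_star_tfShift, smul_smul, ← expi_add, add_neg_cancel, expi_zero, one_smul]
    have h2 : star (tfShift z) * conjShift w X =
        expi (sympl w z) • conjShift w (star (tfShift z) * X) := by
      rw [conjShift_mul, ← smul_mul_assoc, ← h]
    rw [sub_apply, one_apply_eq_self, mul_sub, map_sub, h2, map_smul, hφ, smul_eq_mul, sub_mul,
      one_mul]
  induction j with
  | zero => simp
  | succ j ih => rw [pow_succ', mul_apply_eq_comp, hstep, ih]; ring

/-- An element of `𝒜¹_n` has differences of order `j ≤ n` bounded by `C |w|^j`. -/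
theorem IsExpansion.norm_sub_one_pow_le {n : ℕ} {Γ : AddSubgroup (ℝ × ℝ)} {a : Γ → ℂ}
    {T : L2R →L[ℂ] L2R} (h : IsExpansion n Γ a T) (w : ℝ × ℝ) {j : ℕ} (hj : j ≤ n) :
    ‖((conjShift w - 1) ^ j) T‖ ≤
      (∑' z : Γ, ‖a z‖ * weight n z) * (2 * Real.pi * √(w.1 ^ 2 + w.2 ^ 2)) ^ j := by
  have h2 := h.2.mapL ((conjShift w - 1) ^ j)
  refine h2.norm_le_of_bounded (h.1.hasSum.mul_right _) fun z => ?_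
  rw [map_smul, sub_one_pow_tfShift, norm_smul, norm_smul, norm_pow, mul_assoc]
  refine mul_le_mul_of_nonneg_left ?_ (norm_nonneg _)
  have h3 : ‖expi (sympl w z) - 1‖ ≤ √((z : ℝ × ℝ).1 ^ 2 + (z : ℝ × ℝ).2 ^ 2) *
      (2 * Real.pi * √(w.1 ^ 2 + w.2 ^ 2)) := by
    refine (norm_expi_sub_one_le _).trans ?_
    calc _ ≤ 2 * Real.pi * _ := mul_le_mul_of_nonneg_left (abs_sympl_le w z) (by positivity)
      _ = _ := by ring
  have h4 : √((z : ℝ × ℝ).1 ^ 2 + (z : ℝ × ℝ).2 ^ 2) ^ j ≤ weight n z := by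
    rw [weight, Real.sqrt_eq_rpow, ← Real.rpow_natCast, ← Real.rpow_mul (by positivity)]
    refine (Real.rpow_le_rpow (by positivity) (le_add_of_nonneg_left zero_le_one)
      (by positivity)).trans ?_
    refine Real.rpow_le_rpow_of_exponent_le ?_ ?_
    · exact le_add_of_nonneg_right (by positivity)
    · have : (j : ℝ) ≤ n := by exact_mod_cast hj
      simp only [NNReal.coe_natCast]
      linarith
  calc _ ≤ (√((z : ℝ × ℝ).1 ^ 2 + (z : ℝ × ℝ).2 ^ 2) *
      (2 * Real.pi * √(w.1 ^ 2 + w.2 ^ 2))) ^ j * 1 := by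
        gcongr
        exact norm_tfShift_le _
    _ ≤ _ := by
        rw [mul_one, mul_pow]
        gcongr

theorem mem_smoothTorus_iff {Γ : AddSubgroup (ℝ × ℝ)} {T : L2R →L[ℂ] L2R} :
    T ∈ smoothTorus Γ ↔ ∀ s : ℝ≥0, ∃ a, IsExpansion s Γ a T := by
  simp only [smoothTorus, StarSubalgebra.mem_iInf]
  rfl

/-- The Fourier coefficients of the inverse of a smooth element decay rapidly. -/
theorem exists_coeff_inverse_le {Γ : AddSubgroup (ℝ × ℝ)} {T Y : L2R →L[ℂ] L2R}
    (hT : T ∈ smoothTorus Γ) (hTY : T * Y = 1) (hYT : Y * T = 1)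
    (hφ : ∀ w X, φ (conjShift w X) = φ X) (n : ℕ) :
    ∃ C : ℝ, 0 ≤ C ∧ ∀ z : ℝ × ℝ,
      ‖φ (star (tfShift z) * Y)‖ * √(z.1 ^ 2 + z.2 ^ 2) ^ n ≤ C := by
  obtain ⟨a, ha⟩ := mem_smoothTorus_iff.1 hT n
  obtain ⟨C, hC, h⟩ := exists_norm_sub_one_pow_inverse_le (R := L2R →L[ℂ] L2R) n
    (∑' z : Γ, ‖a z‖ * weight n z) ‖Y‖
    (tsum_nonneg fun z => mul_nonneg (norm_nonneg _) (zero_le_one.trans (one_le_weight _ _)))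
    (norm_nonneg _)
  have hb : ∀ X, ‖φ (star (tfShift X) * Y)‖ ≤ ‖φ‖ * ‖Y‖ := fun X =>
    (φ.le_opNorm _).trans (mul_le_mul_of_nonneg_left ((norm_mul_le _ _).trans
      (mul_le_of_le_one_left (norm_nonneg _) (norm_star_tfShift_le X))) (norm_nonneg _))
  refine ⟨‖φ‖ * ‖Y‖ + ‖φ‖ * (C * Real.pi ^ n), by positivity, fun z => ?_⟩
  rcases eq_or_ne z 0 with rfl | hz
  · have h0 : √((0 : ℝ × ℝ).1 ^ 2 + (0 : ℝ × ℝ).2 ^ 2) ^ n ≤ 1 :=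
      pow_le_one₀ (Real.sqrt_nonneg _) (by simp)
    calc _ ≤ (‖φ‖ * ‖Y‖) * 1 := mul_le_mul (hb 0) h0 (by positivity) (by positivity)
      _ ≤ _ := by rw [mul_one]; exact le_add_of_nonneg_right (by positivity)
  · obtain ⟨w, hw, hwn⟩ := exists_sympl_eq_half hz
    have hpos : 0 < √(z.1 ^ 2 + z.2 ^ 2) := by
      by_contra! h0
      have h1 : √(z.1 ^ 2 + z.2 ^ 2) = 0 := le_antisymm h0 (Real.sqrt_nonneg _)
      rw [Real.sqrt_eq_zero (by positivity)] at h1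
      refine hz (Prod.ext ?_ ?_)
      · exact pow_eq_zero_iff two_ne_zero |>.1
          (le_antisymm (by nlinarith [sq_nonneg z.2]) (sq_nonneg z.1))
      · exact pow_eq_zero_iff two_ne_zero |>.1
          (le_antisymm (by nlinarith [sq_nonneg z.1]) (sq_nonneg z.2))
    -- At this w the multiplier is (-2)^n, while the order-n difference of Y is at most C(2π|w|)^n.
    -- Since |w||z| = 1/2, the product with |z|^n leaves C π^n; the gain 2^n is discarded.
    have h1 := h (conjShift w) (conjShift_mul w) (norm_conjShift_apply_le w) (conjShift_one w)
      (2 * Real.pi * √(w.1 ^ 2 + w.2 ^ 2)) (by positivity) T Y hTY hYT le_rfl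
      (fun j hj => ha.norm_sub_one_pow_le w hj) n le_rfl
    have h2 := state_sub_one_pow hφ w z n Y
    rw [hw, expi_half] at h2
    have h3 : ‖φ (star (tfShift z) * ((conjShift w - 1) ^ n) Y)‖ ≤
        ‖φ‖ * (C * (2 * Real.pi * √(w.1 ^ 2 + w.2 ^ 2)) ^ n) :=
      (φ.le_opNorm _).trans (mul_le_mul_of_nonneg_left ((norm_mul_le _ _).trans
        ((mul_le_of_le_one_left (norm_nonneg _) (norm_star_tfShift_le z)).trans h1))
          (norm_nonneg _))
    rw [h2, norm_mul, norm_pow, show ‖(-1 - 1 : ℂ)‖ = 2 by norm_num, hwn] at h3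
    have h4 : (1 : ℝ) ≤ 2 ^ n := one_le_pow₀ one_le_two
    calc _ ≤ (2 ^ n * ‖φ (star (tfShift z) * Y)‖) * √(z.1 ^ 2 + z.2 ^ 2) ^ n := by
          gcongr
          exact le_mul_of_one_le_left (norm_nonneg _) h4
      _ ≤ (‖φ‖ * (C * (2 * Real.pi * (2 * √(z.1 ^ 2 + z.2 ^ 2))⁻¹) ^ n)) *
          √(z.1 ^ 2 + z.2 ^ 2) ^ n := by gcongr
      _ = ‖φ‖ * (C * (2 * Real.pi * (2 * √(z.1 ^ 2 + z.2 ^ 2))⁻¹ * √(z.1 ^ 2 + z.2 ^ 2)) ^ n) := by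
          rw [mul_pow _ (√(z.1 ^ 2 + z.2 ^ 2))]; ring
      _ = ‖φ‖ * (C * Real.pi ^ n) := by
          congr 3
          field_simp
      _ ≤ _ := le_add_of_nonneg_left (by positivity)

end Coefficients

/-! ### Weights and spectral invariance of the smooth torus -/

theorem weight_add (s t : ℝ≥0) (z : ℝ × ℝ) : weight (s + t) z = weight s z * weight t z := by
  unfold weight
  rw [← Real.rpow_add (by positivity)]
  congr 1
  push_cast
  ring

theorem weight_le (s : ℝ≥0) : ∃ n : ℕ, ∀ z : ℝ × ℝ,
    weight s z ≤ 2 ^ n * (1 + √(z.1 ^ 2 + z.2 ^ 2) ^ n) := by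
  obtain ⟨n, hn⟩ := exists_nat_ge (s : ℝ)
  refine ⟨n, fun z => ?_⟩
  set q := √(z.1 ^ 2 + z.2 ^ 2) with hq
  have hq0 : 0 ≤ q := Real.sqrt_nonneg _
  have h1 : weight s z ≤ (1 + q) ^ n := by
    have h2 : 1 + (z.1 ^ 2 + z.2 ^ 2) ≤ (1 + q) ^ (2 : ℝ) := by
      have : q ^ 2 = z.1 ^ 2 + z.2 ^ 2 := Real.sq_sqrt (by positivity)
      rw [← this]
      norm_cast
      nlinarith
    calc weight s z ≤ ((1 + q) ^ (2 : ℝ)) ^ ((s : ℝ) / 2) :=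
          Real.rpow_le_rpow (by positivity) h2 (by positivity)
      _ = (1 + q) ^ (s : ℝ) := by
          rw [← Real.rpow_mul (by positivity)]
          congr 1
          ring
      _ ≤ (1 + q) ^ (n : ℝ) := Real.rpow_le_rpow_of_exponent_le (by linarith) hn
      _ = _ := Real.rpow_natCast _ _
  refine h1.trans ?_
  calc (1 + q) ^ n ≤ 2 ^ (n - 1) * (1 ^ n + q ^ n) := add_pow_le zero_le_one hq0 n
    _ ≤ _ := by
      rw [one_pow]
      gcongr
      · exact one_le_two
      · omega

/-- Rapidly decaying coefficients are summable against every weight. -/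
theorem summable_mul_weight {Γ : AddSubgroup (ℝ × ℝ)} {t : ℝ≥0}
    (hΓ : Summable fun z : Γ => (weight t z)⁻¹) {b : Γ → ℂ}
    (hb : ∀ n : ℕ, ∃ C : ℝ, ∀ z : Γ,
      ‖b z‖ * √((z : ℝ × ℝ).1 ^ 2 + (z : ℝ × ℝ).2 ^ 2) ^ n ≤ C) (s : ℝ≥0) :
    Summable fun z : Γ => ‖b z‖ * weight s z := by
  obtain ⟨n, hn⟩ := weight_le (s + t)
  obtain ⟨C₀, h₀⟩ := hb 0
  obtain ⟨C₁, h₁⟩ := hb n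
  have hw : ∀ (s : ℝ≥0) (z : ℝ × ℝ), 0 < weight s z := fun s z =>
    zero_lt_one.trans_le (one_le_weight s z)
  refine (hΓ.mul_left (2 ^ n * (C₀ + C₁))).of_nonneg_of_le
    (fun z => mul_nonneg (norm_nonneg _) (hw s z).le) fun z => ?_
  rw [← div_eq_mul_inv, le_div_iff₀ (hw t z), mul_assoc, ← weight_add]
  calc _ ≤ ‖b z‖ * _ := mul_le_mul_of_nonneg_left (hn z) (norm_nonneg _)
    _ = 2 ^ n * (‖b z‖ * √((z : ℝ × ℝ).1 ^ 2 + (z : ℝ × ℝ).2 ^ 2) ^ 0 +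
        ‖b z‖ * √((z : ℝ × ℝ).1 ^ 2 + (z : ℝ × ℝ).2 ^ 2) ^ n) := by ring
    _ ≤ _ := by
      gcongr
      · exact h₀ z
      · exact h₁ z

/-- A family with summable coefficients defines an operator. -/
theorem summable_smul_tfShift {Γ : AddSubgroup (ℝ × ℝ)} {b : Γ → ℂ} (hb : Summable fun z => ‖b z‖) :
    Summable (fun z : Γ => b z • tfShift (z : ℝ × ℝ)) :=
  .of_norm (hb.of_nonneg_of_le (fun _ => norm_nonneg _) fun z => by
    rw [norm_smul]
    exact mul_le_of_le_one_right (norm_nonneg _) (norm_tfShift_le _))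

/-- The smooth noncommutative torus is closed under inversion in `B(L²)`. -/
theorem inverse_mem_smoothTorus {Γ : AddSubgroup (ℝ × ℝ)} {t : ℝ≥0}
    (hΓ : Summable fun z : Γ => (weight t z)⁻¹) {T Y : L2R →L[ℂ] L2R}
    (hT : T ∈ smoothTorus Γ) (hTY : T * Y = 1) (hYT : Y * T = 1) : Y ∈ smoothTorus Γ := by
  obtain ⟨φ, h1, hφ⟩ := exists_invariant_state
  set b : Γ → ℂ := fun z => φ (star (tfShift z) * Y) with hb
  have hdecay : ∀ n : ℕ, ∃ C : ℝ, ∀ z : Γ,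
      ‖b z‖ * √((z : ℝ × ℝ).1 ^ 2 + (z : ℝ × ℝ).2 ^ 2) ^ n ≤ C := fun n => by
    obtain ⟨C, -, hC⟩ := exists_coeff_inverse_le hT hTY hYT hφ n
    exact ⟨C, fun z => hC z⟩
  have hsum := summable_mul_weight hΓ hdecay
  have hsum0 : Summable fun z => ‖b z‖ := by simpa [weight] using hsum 0
  obtain ⟨X, hX⟩ := summable_smul_tfShift hsum0
  have hXe : ∀ s, IsExpansion s Γ b X := fun s => ⟨hsum s, hX⟩
  -- X and Y agree in their coefficients over Γ. This does not yet give X = Y: no expansion of Y is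
  -- known, and φ has not been shown to separate operators.
  have hZ : ∀ z : Γ, φ (star (tfShift z) * (X - Y)) = 0 := fun z => by
    rw [mul_sub, map_sub, (hXe 0).state_eq h1 hφ, sub_self]
  obtain ⟨a, ha⟩ := mem_smoothTorus_iff.1 hT 0
  -- Expanding T, the coefficient of T(X - Y) at z is a combination of coefficients of X - Y at the
  -- points z - u of Γ.
  have hTZ : ∀ z : Γ, φ (star (tfShift z) * (T * (X - Y))) = 0 := fun z => by
    have h2 := (((ha.2.mul_right (X - Y)).mul_left (star (tfShift z))).mapL φ)
    refine h2.unique ?_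
    convert hasSum_zero with u
    have h3 : star (tfShift (z : ℝ × ℝ)) * (a u • tfShift (u : ℝ × ℝ) * (X - Y)) =
        (a u * expi (-((z : ℝ × ℝ).1 * (z : ℝ × ℝ).2)) *
          expi (-(((-z : Γ) : ℝ × ℝ).1 * (u : ℝ × ℝ).2)) *
          (expi (-(((z - u : Γ) : ℝ × ℝ).1 * ((z - u : Γ) : ℝ × ℝ).2)))⁻¹) •
          (star (tfShift ((z - u : Γ) : ℝ × ℝ)) * (X - Y)) := by
      rw [star_tfShift, star_tfShift, smul_mul_assoc, smul_mul_assoc, smul_mul_assoc,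
        mul_smul_comm, ← mul_assoc, tfShift_mul, smul_mul_assoc, smul_smul, smul_smul, smul_smul,
        mul_assoc _ _⁻¹, inv_mul_cancel₀ (expi_ne_zero _), mul_one]
      congr 1
      · simp only [NegMemClass.coe_neg]; ring
      · congr 2
        push_cast
        abel
    rw [h3, map_smul, hZ, smul_zero]
  -- TX and 1 = TY have equal coefficients over Γ, and both TX and 1 do have expansions, so they
  -- coincide.
  have hTX : T * X = 1 := by
    obtain ⟨d, hd⟩ := ha.mul (hXe 0)
    obtain ⟨e, he⟩ := isExpansion_smul_one 0 Γ 1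
    rw [one_smul] at he
    have hde : d = e := by
      ext z
      rw [← hd.state_eq h1 hφ z, ← he.state_eq h1 hφ z, ← sub_eq_zero, ← map_sub, ← mul_sub]
      rw [← hTY, ← mul_sub, hTZ]
    rw [hde] at hd
    exact hd.2.unique he.2
  have hXY : X = Y := by
    calc X = Y * T * X := by rw [hYT, one_mul]
      _ = Y := by rw [mul_assoc, hTX, mul_one]
  rw [mem_smoothTorus_iff]
  exact fun s => ⟨b, hXY ▸ hXe s⟩

/-! ### Poisson summation on ℤ^d -/

section Poisson

variable {d : Type*}

/-- The unit box with lower corner `k`. -/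
def unitBox (k : d → ℤ) : Set (d → ℝ) := {u | ∀ i, u i ∈ Set.Ioc (k i : ℝ) (k i + 1)}

theorem pairwise_disjoint_unitBox : Pairwise (Function.onFun Disjoint (unitBox (d := d))) := by
  intro k l hkl
  refine Set.disjoint_left.2 fun u hk hl => hkl (funext fun i => ?_)
  have h1 := hk i
  have h2 := hl i
  have h3 : (k i : ℝ) < l i + 1 := h1.1.trans_le h2.2
  have h4 : (l i : ℝ) < k i + 1 := h2.1.trans_le h1.2
  have h5 : k i < l i + 1 := by exact_mod_cast h3
  have h6 : l i < k i + 1 := by exact_mod_cast h4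
  omega

theorem iUnion_unitBox : ⋃ k, unitBox (d := d) k = Set.univ := by
  refine Set.eq_univ_of_forall fun u => Set.mem_iUnion.2 ⟨fun i => ⌈u i⌉ - 1, fun i => ?_⟩
  have h1 := Int.ceil_lt_add_one (u i)
  have h2 := Int.le_ceil (u i)
  push_cast
  exact ⟨by linarith, by linarith⟩

variable [Fintype d]

theorem measurableSet_unitBox (k : d → ℤ) : MeasurableSet (unitBox k) :=
  MeasurableSet.univ_pi' fun _ => measurableSet_Ioc

theorem setIntegral_unitBox {E : Type*} [NormedAddCommGroup E] [NormedSpace ℝ E]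
    (H : (d → ℝ) → E) (k : d → ℤ) :
    ∫ u in unitBox 0, H (u + fun i => (k i : ℝ)) = ∫ u in unitBox k, H u := by
  rw [← (measurePreserving_add_right volume (fun i => (k i : ℝ))).setIntegral_preimage_emb
    (measurableEmbedding_addRight _) H]
  congr 2
  ext u
  simp only [Set.mem_preimage, unitBox, Set.mem_ofPred_eq]
  refine forall_congr' fun i => ?_
  simp only [Pi.zero_apply, Int.cast_zero, zero_add, Pi.add_apply, Set.mem_Ioc]
  constructor <;> rintro ⟨h1, h2⟩ <;> constructor <;> linarith

theorem hasSum_setIntegral_unitBox {E : Type*} [NormedAddCommGroup E] [NormedSpace ℝ E]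
    {H : (d → ℝ) → E} (hH : Integrable H) :
    HasSum (fun k : d → ℤ => ∫ u in unitBox 0, H (u + fun i => (k i : ℝ))) (∫ u, H u) := by
  simp only [setIntegral_unitBox]
  rw [← setIntegral_univ, ← iUnion_unitBox]
  exact hasSum_integral_iUnion measurableSet_unitBox pairwise_disjoint_unitBox hH.integrableOn

theorem mFourier_coe (n : d → ℤ) (u : d → ℝ) :
    UnitAddTorus.mFourier n (fun i => (u i : UnitAddCircle)) = expi (∑ i, n i * u i) := by
  simp only [UnitAddTorus.mFourier, ContinuousMap.coe_mk, fourier_coe_apply, expi]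
  rw [← Complex.exp_sum]
  congr 1
  push_cast
  rw [Finset.mul_sum]
  refine Finset.sum_congr rfl fun i _ => ?_
  ring

theorem expi_intCast (n : ℤ) : expi n = 1 := by
  rw [expi, show (2 * Real.pi * Complex.I * ((n : ℝ) : ℂ)) = n * (2 * Real.pi * Complex.I) by
    push_cast; ring]
  exact Complex.exp_int_mul_two_pi_mul_I n

theorem expi_eq_one_iff (r : ℝ) : expi r = 1 ↔ ∃ n : ℤ, r = n := by
  refine ⟨fun h => ?_, fun ⟨n, hn⟩ => hn ▸ expi_intCast n⟩
  rw [expi, Complex.exp_eq_one_iff] at h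
  obtain ⟨n, hn⟩ := h
  refine ⟨n, ?_⟩
  have h1 : (2 * Real.pi * Complex.I : ℂ) * (r : ℂ) = (2 * Real.pi * Complex.I) * (n : ℂ) := by
    rw [hn]; ring
  have h2 := mul_left_cancel₀ Complex.two_pi_I_ne_zero h1
  exact_mod_cast h2

/-- The Poisson summation formula for `ℤ^d`. -/
theorem tsum_eq_tsum_integral_expi {G : (d → ℝ) → ℂ} (hc : Continuous G) (hi : Integrable G)
    {M : (d → ℝ) → ℝ} (hM : Continuous M) {b : (d → ℤ) → ℝ} (hb : Summable b)
    (hb0 : ∀ k, 0 ≤ b k) (hG : ∀ u (k : d → ℤ), ‖G (u + fun i => (k i : ℝ))‖ ≤ M u * b k)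
    (hs : Summable fun n : d → ℤ => ∫ u, expi (-∑ i, (n i : ℝ) * u i) * G u) :
    ∑' k : d → ℤ, G (fun i => (k i : ℝ)) =
      ∑' n : d → ℤ, ∫ u, expi (-∑ i, (n i : ℝ) * u i) * G u := by
  let P : (d → ℝ) → ℂ := fun u => ∑' k : d → ℤ, G (u + fun i => (k i : ℝ))
  have hPc : Continuous P := by
    refine continuous_iff_continuousAt.2 fun u₀ => ?_
    -- Near u₀ the translates are dominated by the fixed summable family (M u₀ + 1) b k, so the
    -- periodization is continuous.
    have hU : {u | M u < M u₀ + 1} ∈ nhds u₀ :=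
      (isOpen_lt hM continuous_const).mem_nhds (by simp)
    refine ContinuousOn.continuousAt ?_ hU
    refine continuousOn_tsum (u := fun k => (M u₀ + 1) * b k)
      (fun k => (hc.comp (continuous_id.add continuous_const)).continuousOn)
      (hb.mul_left _) fun k u hu => ?_
    exact (hG u k).trans (mul_le_mul_of_nonneg_right (le_of_lt hu) (hb0 k))
  have hPper : ∀ u (l : d → ℤ), P (u + fun i => (l i : ℝ)) = P u := by
    intro u l
    refine ((Equiv.addLeft l).tsum_eq
      (fun k : d → ℤ => G (u + fun i => (k i : ℝ)))).symm.trans ?_ |>.symm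
    refine tsum_congr fun k => ?_
    congr 1
    ext i
    simp [add_assoc]
  let q : (d → ℝ) → UnitAddTorus d := fun u i => (u i : UnitAddCircle)
  have hq : IsOpenQuotientMap q :=
    IsOpenQuotientMap.piMap fun _ => QuotientAddGroup.isOpenQuotientMap_mk
  -- The periodization descends to the torus: by periodicity the choice of preimage is immaterial.
  let Q₀ : UnitAddTorus d → ℂ := fun x => P (Function.surjInv hq.surjective x)
  have hQ₀ : ∀ u, Q₀ (q u) = P u := by
    intro u
    have h1 : q (Function.surjInv hq.surjective (q u)) = q u := Function.surjInv_eq _ _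
    have h2 : ∀ i, ∃ m : ℤ, Function.surjInv hq.surjective (q u) i = u i + m := by
      intro i
      have h3 : ((Function.surjInv hq.surjective (q u) i : ℝ) : UnitAddCircle) = (u i : ℝ) :=
        congrFun h1 i
      rw [← sub_eq_zero, ← AddCircle.coe_sub, AddCircle.coe_eq_zero_iff] at h3
      obtain ⟨m, hm⟩ := h3
      refine ⟨m, ?_⟩
      rw [zsmul_eq_mul, mul_one] at hm
      linarith
    choose m hm using h2
    have h4 : Function.surjInv hq.surjective (q u) = u + fun i => (m i : ℝ) := funext hm
    change P (Function.surjInv hq.surjective (q u)) = P u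
    rw [h4, hPper]
  have hQc : Continuous Q₀ := by
    rw [hq.isQuotientMap.continuous_iff]
    exact hPc.congr fun u => (hQ₀ u).symm
  let Q : C(UnitAddTorus d, ℂ) := ⟨Q₀, hQc⟩
  have hcoeff : ∀ n, UnitAddTorus.mFourierCoeff Q n = ∫ u, expi (-∑ i, (n i : ℝ) * u i) * G u := by
    intro n
    let χ : (d → ℝ) → ℂ := fun u => expi (-∑ i, (n i : ℝ) * u i)
    have hχc : Continuous χ := continuous_expi.comp (by fun_prop)
    -- The character is periodic, so it can be moved inside the sum of translates; the unit boxes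
    -- then tile the space and unfold the coefficient to an integral over ℝ^d.
    have hχper : ∀ u (k : d → ℤ), χ (u + fun i => (k i : ℝ)) = χ u := by
      intro u k
      have h1 : -∑ i, (n i : ℝ) * (u + fun i => (k i : ℝ)) i =
          (-∑ i, (n i : ℝ) * u i) + ((-∑ i, n i * k i : ℤ) : ℝ) := by
        push_cast
        simp only [Pi.add_apply, mul_add, Finset.sum_add_distrib]
        ring
      simp only [χ]
      rw [h1, expi_add, expi_intCast, mul_one]
    have hint : Integrable (fun u => χ u * G u) := by
      refine (integrable_norm_iff (hχc.mul hc).aestronglyMeasurable).1 ?_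
      refine hi.norm.congr (Filter.Eventually.of_forall fun u => ?_)
      simp [χ, norm_expi]
    rw [UnitAddTorus.mFourierCoeff_eq_integral _ _ 0]
    have hset : {x : d → ℝ | ∀ i, x i ∈ Set.Ioc ((0 : d → ℝ) i) ((0 : d → ℝ) i + 1)} =
        unitBox 0 := by
      simp [unitBox]
    rw [hset]
    have h1 : ∀ u : d → ℝ, UnitAddTorus.mFourier (-n) (fun i => (u i : UnitAddCircle)) •
        Q (fun i => (u i : UnitAddCircle)) =
        ∑' k : d → ℤ, χ (u + fun i => (k i : ℝ)) * G (u + fun i => (k i : ℝ)) := by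
      intro u
      have h2 : Q (fun i => (u i : UnitAddCircle)) = P u := hQ₀ u
      rw [mFourier_coe, h2, smul_eq_mul]
      simp only [hχper, P, tsum_mul_left]
      congr 2
      simp
    simp only [h1]
    have h3 : ∀ k : d → ℤ, IntegrableOn
        (fun u => χ (u + fun i => (k i : ℝ)) * G (u + fun i => (k i : ℝ))) (unitBox 0) :=
      fun k => (hint.comp_add_right (fun i => (k i : ℝ))).integrableOn
    have h4 := hasSum_integral_of_summable_integral_norm h3
      (hasSum_setIntegral_unitBox hint.norm).summable
    exact h4.unique (hasSum_setIntegral_unitBox hint)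
  have hsum : Summable (UnitAddTorus.mFourierCoeff Q) := by
    exact hs.congr fun n => (hcoeff n).symm
  have h5 := (UnitAddTorus.hasSum_mFourier_series_apply_of_summable hsum (q 0)).tsum_eq
  have h6 : Q (q 0) = ∑' k : d → ℤ, G (fun i => (k i : ℝ)) := by
    refine (hQ₀ 0).trans (tsum_congr fun k => ?_)
    rw [zero_add]
  rw [← h6, ← h5]
  refine tsum_congr fun n => ?_
  have h7 : UnitAddTorus.mFourier n (q 0) = 1 := by
    rw [mFourier_coe]
    simp [expi_zero]
  rw [h7, smul_eq_mul, mul_one, hcoeff]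

end Poisson

/-! ### Lattices, their symplectic duals and Poisson summation over them -/

section Lattice

theorem weight_pos (s : ℝ≥0) (z : ℝ × ℝ) : 0 < weight s z :=
  zero_lt_one.trans_le (one_le_weight s z)

theorem continuous_weight (s : ℝ≥0) : Continuous (weight s) := by
  unfold weight
  exact Continuous.rpow_const (by fun_prop) fun z => Or.inl (by positivity)

/-- Compared after squaring; 4 rounds up √8. The exponent 3 exceeds the dimension 2, so the
reciprocal weight is integrable on the plane and summable over lattices. -/
theorem one_add_norm_pow_le_weight (w : ℝ × ℝ) : (1 + ‖w‖) ^ 3 ≤ 4 * weight 3 w := by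
  have hw := weight_pos 3 w
  refine (pow_le_pow_iff_left₀ (by positivity) (by positivity) two_ne_zero).1 ?_
  have h1 : weight 3 w ^ 2 = (1 + (w.1 ^ 2 + w.2 ^ 2)) ^ 3 := by
    rw [weight, ← Real.rpow_natCast, ← Real.rpow_mul (by positivity), ← Real.rpow_natCast]
    norm_num
  have h2 : ‖w‖ ^ 2 ≤ w.1 ^ 2 + w.2 ^ 2 := by
    rw [Prod.norm_def]
    rcases max_cases ‖w.1‖ ‖w.2‖ with h | h <;> rw [h.1, Real.norm_eq_abs, sq_abs]
    · exact le_add_of_nonneg_right (sq_nonneg _)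
    · exact le_add_of_nonneg_left (sq_nonneg _)
  have h3 : (1 + ‖w‖) ^ 2 ≤ 2 * (1 + (w.1 ^ 2 + w.2 ^ 2)) := by
    nlinarith [sq_nonneg (1 - ‖w‖)]
  calc ((1 + ‖w‖) ^ 3) ^ 2 = ((1 + ‖w‖) ^ 2) ^ 3 := by ring
    _ ≤ (2 * (1 + (w.1 ^ 2 + w.2 ^ 2))) ^ 3 := by gcongr
    _ = 8 * weight 3 w ^ 2 := by rw [h1]; ring
    _ ≤ _ := by nlinarith [sq_nonneg (weight 3 w)]

theorem inv_weight_le (w : ℝ × ℝ) : (weight 3 w)⁻¹ ≤ 4 * (1 + ‖w‖) ^ (-3 : ℝ) := by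
  have h := one_add_norm_pow_le_weight w
  rw [Real.rpow_neg (by positivity), ← div_eq_mul_inv, inv_eq_one_div,
    div_le_div_iff₀ (weight_pos _ _) (by positivity)]
  norm_cast
  linarith

theorem integrable_inv_weight : Integrable fun w : ℝ × ℝ => (weight 3 w)⁻¹ := by
  have h : Integrable fun w : ℝ × ℝ => (1 + ‖w‖) ^ (-3 : ℝ) :=
    integrable_one_add_norm (by simp; norm_num)
  refine (h.const_mul 4).mono' ?_ (Filter.Eventually.of_forall fun w => ?_)
  · exact ((continuous_weight 3).inv₀ fun w => (weight_pos 3 w).ne').aestronglyMeasurable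
  · rw [Real.norm_of_nonneg (inv_nonneg.2 (weight_pos _ _).le)]
    exact inv_weight_le w

/-- Compare with Σ ‖k‖^{-3} over nonzero k in ℤ², using ‖k‖ ≤ ‖A⁻¹‖‖Ak‖; the single term k = 0 is
irrelevant. -/
theorem summable_inv_weight_linearEquiv (A : (Fin 2 → ℝ) ≃ₗ[ℝ] ℝ × ℝ) :
    Summable fun k : Fin 2 → ℤ => (weight 3 (A fun i => (k i : ℝ)))⁻¹ := by
  have h := EisensteinSeries.summable_one_div_norm_rpow (k := 3) (by norm_num)
  let A' := A.symm.toContinuousLinearEquiv.toContinuousLinearMap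
  refine (h.mul_left (4 * (‖A'‖ + 1) ^ 3)).of_norm_bounded_eventually ?_
  have h0 : {k : Fin 2 → ℤ | k = 0}.Finite := Set.finite_singleton 0
  filter_upwards [h0.compl_mem_cofinite] with k hk
  have hk0 : 0 < ‖k‖ := norm_pos_iff.2 hk
  rw [Real.norm_of_nonneg (inv_nonneg.2 (weight_pos _ _).le)]
  refine (inv_weight_le _).trans ?_
  rw [mul_assoc]
  refine mul_le_mul_of_nonneg_left ?_ (by norm_num)
  have h1 : ‖k‖ ≤ (‖A'‖ + 1) * (1 + ‖A fun i => (k i : ℝ)‖) := by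
    have h2 : ‖k‖ = ‖(fun i => (k i : ℝ) : Fin 2 → ℝ)‖ := by
      simp [Pi.norm_def]
      rfl
    have h3 := A'.le_opNorm (A fun i => (k i : ℝ))
    have h4 : A' (A fun i => (k i : ℝ)) = fun i => (k i : ℝ) := A.symm_apply_apply _
    rw [h4, ← h2] at h3
    nlinarith [norm_nonneg A', norm_nonneg (A fun i => (k i : ℝ))]
  rw [Real.rpow_neg (by positivity), Real.rpow_neg hk0.le, ← div_eq_mul_inv, inv_eq_one_div,
    div_le_div_iff₀ (by positivity) (by positivity), one_mul]
  norm_cast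
  rw [← mul_pow]
  gcongr

/-- Lebesgue measure is carried to a Haar measure, hence to a positive multiple of Lebesgue measure;
the value of the factor plays no role. -/
theorem integral_comp_linearEquiv (A : (Fin 2 → ℝ) ≃ₗ[ℝ] ℝ × ℝ) :
    ∃ c : ℝ, 0 < c ∧ (∀ H : ℝ × ℝ → ℂ, ∫ u, H (A u) = c * ∫ w, H w) ∧
      ∀ H : ℝ × ℝ → ℂ, Integrable H → Integrable fun u => H (A u) := by
  let A' := A.toContinuousLinearEquiv
  have hH : (Measure.map A (volume : Measure (Fin 2 → ℝ))).IsAddHaarMeasure :=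
    A'.isAddHaarMeasure_map volume
  have hm : MeasurableEmbedding A := A'.toHomeomorph.measurableEmbedding
  set c := Measure.addHaarScalarFactor (Measure.map A (volume : Measure (Fin 2 → ℝ))) volume
  have hc : Measure.map A (volume : Measure (Fin 2 → ℝ)) = c • volume :=
    Measure.isAddLeftInvariant_eq_smul _ _
  have hc0 : c ≠ 0 := (Measure.addHaarScalarFactor_pos_of_isAddHaarMeasure _ _).ne'
  refine ⟨c, by exact_mod_cast pos_iff_ne_zero.2 hc0, fun H => ?_, fun H hHi => ?_⟩
  · rw [← hm.integral_map, hc, integral_smul_nnreal_measure, NNReal.smul_def, Complex.real_smul]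
  · rw [← Function.comp_def, ← hm.integrable_map_iff, hc]
    exact hHi.smul_measure_nnreal

theorem exists_linearEquiv (Λ : Submodule ℤ (ℝ × ℝ)) [DiscreteTopology Λ] [IsZLattice ℝ Λ] :
    ∃ A : (Fin 2 → ℝ) ≃ₗ[ℝ] ℝ × ℝ,
      ∀ w, w ∈ Λ ↔ ∃ k : Fin 2 → ℤ, A (fun i => (k i : ℝ)) = w := by
  have h1 : Module.finrank ℤ Λ = 2 := by
    rw [ZLattice.rank ℝ Λ]
    simp
  have : Module.Finite ℤ Λ := ZLattice.module_finite ℝ Λ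
  have : Module.Free ℤ Λ := ZLattice.module_free ℝ Λ
  let b : Module.Basis (Fin 2) ℤ Λ := Module.finBasisOfFinrankEq ℤ Λ h1
  let B := b.ofZLatticeBasis ℝ Λ
  refine ⟨B.equivFun.symm, fun w => ?_⟩
  have h2 : Submodule.span ℤ (Set.range B) = Λ := Module.Basis.ofZLatticeBasis_span ℝ Λ b
  rw [← h2, Submodule.mem_span_range_iff_exists_fun]
  simp only [Module.Basis.equivFun_symm_apply, Int.cast_smul_eq_zsmul]

/-- The coordinates, with respect to a basis, dual to the symplectic form. -/
def dualCoord (A : (Fin 2 → ℝ) ≃ₗ[ℝ] ℝ × ℝ) : (ℝ × ℝ) →ₗ[ℝ] (Fin 2 → ℝ) where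
  toFun z i := -sympl (A (Pi.single i 1)) z
  map_add' z w := by ext i; simp [sympl]; ring
  map_smul' c z := by ext i; simp [sympl]; ring

theorem sympl_eq_neg_sum (A : (Fin 2 → ℝ) ≃ₗ[ℝ] ℝ × ℝ) (u : Fin 2 → ℝ) (z : ℝ × ℝ) :
    sympl (A u) z = -∑ i, dualCoord A z i * u i := by
  have h1 : u = u 0 • Pi.single 0 1 + u 1 • Pi.single 1 1 := by
    ext i
    fin_cases i <;> simp
  conv_lhs => rw [h1]
  simp only [map_add, map_smul, Fin.sum_univ_two, dualCoord, LinearMap.coe_mk, AddHom.coe_mk, sympl,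
    Prod.fst_add, Prod.snd_add, Prod.smul_fst, Prod.smul_snd, smul_eq_mul]
  ring

theorem dualCoord_injective (A : (Fin 2 → ℝ) ≃ₗ[ℝ] ℝ × ℝ) : Function.Injective (dualCoord A) := by
  rw [injective_iff_map_eq_zero]
  intro z hz
  have h : ∀ w, sympl w z = 0 := by
    intro w
    rw [← A.apply_symm_apply w, sympl_eq_neg_sum, hz]
    simp
  have h1 := h (0, 1)
  have h2 := h (1, 0)
  simp only [sympl, mul_one, zero_mul, sub_zero, mul_zero, one_mul, zero_sub, neg_eq_zero] at h1 h2
  exact Prod.ext h1 h2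

/-- `dualCoord` as a linear equivalence. -/
def dualCoordEquiv (A : (Fin 2 → ℝ) ≃ₗ[ℝ] ℝ × ℝ) : (ℝ × ℝ) ≃ₗ[ℝ] (Fin 2 → ℝ) :=
  LinearEquiv.ofInjectiveOfFinrankEq (dualCoord A) (dualCoord_injective A) (by simp)

theorem dualCoordEquiv_apply (A : (Fin 2 → ℝ) ≃ₗ[ℝ] ℝ × ℝ) (z : ℝ × ℝ) :
    dualCoordEquiv A z = dualCoord A z := rfl

/-- π(z) commutes with π(λ) exactly when the symplectic pairing of λ and z is an integer. Testing on
a basis of Λ shows that the dual coordinates of z must be integers, and linearity gives the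
converse. -/
theorem mem_dualLattice_iff_exists {Λ : Submodule ℤ (ℝ × ℝ)} {A : (Fin 2 → ℝ) ≃ₗ[ℝ] ℝ × ℝ}
    (hA : ∀ w, w ∈ Λ ↔ ∃ k : Fin 2 → ℤ, A (fun i => (k i : ℝ)) = w) (z : ℝ × ℝ) :
    z ∈ dualLattice Λ.toAddSubgroup ↔
      ∃ n : Fin 2 → ℤ, (dualCoordEquiv A).symm (fun i => (n i : ℝ)) = z := by
  rw [mem_dualLattice_iff]
  simp only [LinearEquiv.symm_apply_eq, dualCoordEquiv_apply]
  constructor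
  · intro h
    have h1 : ∀ i, ∃ n : ℤ, dualCoord A z i = n := by
      intro i
      have h2 := h (A (Pi.single i 1)) ((hA _).2 ⟨Pi.single i 1, by
        congr 1
        ext j
        simp only [Pi.single_apply]
        split_ifs <;> simp⟩)
      obtain ⟨n, hn⟩ := (expi_eq_one_iff _).1 h2
      refine ⟨-n, ?_⟩
      simp [dualCoord, hn]
    choose n hn using h1
    exact ⟨n, funext fun i => (hn i).symm⟩
  · rintro ⟨n, hn⟩ l hl
    obtain ⟨k, rfl⟩ := (hA l).1 hl
    rw [expi_eq_one_iff]
    refine ⟨-∑ i, n i * k i, ?_⟩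
    rw [sympl_eq_neg_sum, ← hn]
    push_cast
    rfl

/-- A lattice given by integral coordinates is in bijection with `ℤ²`. -/
def latticeEquiv {Γ : AddSubgroup (ℝ × ℝ)} {A : (Fin 2 → ℝ) ≃ₗ[ℝ] ℝ × ℝ}
    (hA : ∀ w, w ∈ Γ ↔ ∃ k : Fin 2 → ℤ, A (fun i => (k i : ℝ)) = w) : (Fin 2 → ℤ) ≃ Γ :=
  Equiv.ofBijective (fun k => ⟨A (fun i => (k i : ℝ)), (hA _).2 ⟨k, rfl⟩⟩) (by
    constructor
    · intro k l hkl
      have h := A.injective (Subtype.ext_iff.1 hkl)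
      ext i
      exact_mod_cast congrFun h i
    · rintro ⟨w, hw⟩
      obtain ⟨k, hk⟩ := (hA w).1 hw
      exact ⟨k, Subtype.ext hk⟩)

theorem coe_latticeEquiv {Γ : AddSubgroup (ℝ × ℝ)} {A : (Fin 2 → ℝ) ≃ₗ[ℝ] ℝ × ℝ}
    (hA : ∀ w, w ∈ Γ ↔ ∃ k : Fin 2 → ℤ, A (fun i => (k i : ℝ)) = w) (k : Fin 2 → ℤ) :
    (latticeEquiv hA k : ℝ × ℝ) = A (fun i => (k i : ℝ)) := rfl

theorem summable_inv_weight_dualLattice (Λ : Submodule ℤ (ℝ × ℝ)) [DiscreteTopology Λ]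
    [IsZLattice ℝ Λ] :
    Summable fun z : dualLattice Λ.toAddSubgroup => (weight 3 z)⁻¹ := by
  obtain ⟨A, hA⟩ := exists_linearEquiv Λ
  rw [← (latticeEquiv (mem_dualLattice_iff_exists hA)).summable_iff]
  exact summable_inv_weight_linearEquiv (dualCoordEquiv A).symm

/-- The symplectic Poisson summation formula for a lattice in the time-frequency plane. -/
theorem exists_tsum_eq_mul_tsum_integral (Λ : Submodule ℤ (ℝ × ℝ)) [DiscreteTopology Λ]
    [IsZLattice ℝ Λ] : ∃ c : ℝ, 0 < c ∧ ∀ F : ℝ × ℝ → ℂ, Continuous F →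
      (∃ C : ℝ, ∀ w, ‖F w‖ ≤ C * (weight 3 w)⁻¹) →
      (Summable fun z : dualLattice Λ.toAddSubgroup => ∫ w, expi (sympl w z) * F w) →
      ∑' l : Λ.toAddSubgroup, F l =
        c * ∑' z : dualLattice Λ.toAddSubgroup, ∫ w, expi (sympl w z) * F w := by
  obtain ⟨A, hA⟩ := exists_linearEquiv Λ
  obtain ⟨c, hc, hcA, hcI⟩ := integral_comp_linearEquiv A
  refine ⟨c, hc, fun F hF ⟨C, hC⟩ hs => ?_⟩
  have hC0 : 0 ≤ C := by
    have h1 := (norm_nonneg _).trans (hC 0)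
    exact nonneg_of_mul_nonneg_left h1 (inv_pos.2 (weight_pos _ _))
  have hAc : Continuous A := A.toContinuousLinearEquiv.continuous
  have hFi : Integrable F := (integrable_inv_weight.const_mul C).mono' hF.aestronglyMeasurable
    (Filter.Eventually.of_forall hC)
  let eD := latticeEquiv (mem_dualLattice_iff_exists hA)
  have hterm : ∀ n : Fin 2 → ℤ, ∫ u, expi (-∑ i, (n i : ℝ) * u i) * F (A u) =
      c * ∫ w, expi (sympl w (eD n)) * F w := by
    intro n
    rw [← hcA]
    refine integral_congr_ae (Filter.Eventually.of_forall fun u => ?_)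
    have h2 : dualCoord A ((dualCoordEquiv A).symm fun i => (n i : ℝ)) = fun i => (n i : ℝ) :=
      (dualCoordEquiv A).apply_symm_apply _
    simp only [eD, coe_latticeEquiv, sympl_eq_neg_sum, h2]
  have hsum : Summable fun n : Fin 2 → ℤ => ∫ u, expi (-∑ i, (n i : ℝ) * u i) * F (A u) := by
    simp only [hterm]
    exact ((eD.summable_iff).2 hs).mul_left _
  have h1 := tsum_eq_tsum_integral_expi (G := fun u => F (A u)) (hF.comp hAc) (hcI F hFi)
    (M := fun u => C * (2 ^ ((3 : ℝ≥0) / 2 : ℝ) * weight 3 (A u)))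
    (continuous_const.mul (continuous_const.mul ((continuous_weight 3).comp hAc)))
    (summable_inv_weight_linearEquiv A) (fun k => inv_nonneg.2 (weight_pos _ _).le)
    (fun u k => ?_) hsum
  · rw [← (latticeEquiv hA).tsum_eq, ← eD.tsum_eq, ← tsum_mul_left]
    refine Eq.trans ?_ (h1.trans ?_)
    · rfl
    · exact tsum_congr hterm
  · refine (hC _).trans ?_
    rw [mul_assoc]
    refine mul_le_mul_of_nonneg_left ?_ hC0
    rw [← div_eq_mul_inv, inv_eq_one_div, div_le_div_iff₀ (weight_pos _ _) (weight_pos _ _),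
      one_mul, map_add]
    -- Peetre's inequality: writing Ak = -Au + (Au + Ak) separates the decay in k from a factor
    -- continuous in u.
    have h2 := weight_add_le 3 (-A u) (A u + A fun i => (k i : ℝ))
    rw [neg_add_cancel_left, weight_neg] at h2
    refine h2.trans_eq ?_
    ring

end Lattice

open scoped FourierTransform ComplexConjugate Convolution

/-! ### Short-time Fourier transforms of Schwartz functions -/

section Schwartz

theorem hasDerivAt_expi_mul (ω t : ℝ) : HasDerivAt (fun t : ℝ => expi (t * ω))
    ((2 * Real.pi * Complex.I * ω) * expi (t * ω)) t := by
  have h1 : HasDerivAt (fun t : ℝ => (2 * Real.pi * Complex.I * ((t * ω : ℝ) : ℂ)))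
      (2 * Real.pi * Complex.I * ω) t := by
    have h2 : HasDerivAt (fun t : ℝ => ((t * ω : ℝ) : ℂ)) ((1 * ω : ℝ) : ℂ) t :=
      ((hasDerivAt_id t).mul_const ω).ofReal_comp
    simpa using h2.const_mul (2 * Real.pi * Complex.I : ℂ)
  exact h1.cexp.congr_deriv (mul_comm _ _)

theorem iteratedDeriv_expi_mul (ω : ℝ) (n : ℕ) : iteratedDeriv n (fun t : ℝ => expi (t * ω)) =
    fun t => (2 * Real.pi * Complex.I * ω) ^ n * expi (t * ω) := by
  induction n with
  | zero => simp
  | succ n ih =>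
    rw [iteratedDeriv_succ, ih]
    funext t
    rw [((hasDerivAt_expi_mul ω t).const_mul _).deriv]
    ring

theorem hasTemperateGrowth_expi_mul (ω : ℝ) :
    Function.HasTemperateGrowth fun t : ℝ => expi (t * ω) := by
  refine ⟨?_, fun n => ⟨0, ‖(2 * Real.pi * Complex.I * ω : ℂ) ^ n‖, fun t => ?_⟩⟩
  · have h : ContDiff ℝ (⊤ : ℕ∞) fun t : ℝ => ((t * ω : ℝ) : ℂ) :=
      Complex.ofRealCLM.contDiff.comp (contDiff_id.mul contDiff_const)
    exact (contDiff_const.mul h).cexp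
  · rw [norm_iteratedFDeriv_eq_norm_iteratedDeriv, iteratedDeriv_expi_mul, norm_mul, norm_expi]
    simp

/-- The time-frequency shift of a Schwartz function. -/
def shiftSchwartz (z : ℝ × ℝ) (g : 𝓢(ℝ, ℂ)) : 𝓢(ℝ, ℂ) :=
  SchwartzMap.smulLeftCLM ℂ (fun t : ℝ => expi (t * z.2)) (SchwartzMap.compSubConstCLM ℂ z.1 g)

theorem shiftSchwartz_apply (z : ℝ × ℝ) (g : 𝓢(ℝ, ℂ)) (t : ℝ) :
    shiftSchwartz z g t = expi (t * z.2) * g (t - z.1) := by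
  rw [shiftSchwartz, SchwartzMap.smulLeftCLM_apply_apply (hasTemperateGrowth_expi_mul z.2),
    SchwartzMap.compSubConstCLM_apply, smul_eq_mul]

theorem schwartzL2_shiftSchwartz (z : ℝ × ℝ) (g : 𝓢(ℝ, ℂ)) :
    schwartzL2 (shiftSchwartz z g) = tfShift z (schwartzL2 g) := by
  apply Lp.ext
  filter_upwards [(shiftSchwartz z g).coeFn_toLp 2, coeFn_tfShift z (schwartzL2 g),
    shiftFun_congr z (g.coeFn_toLp 2)] with t h1 h2 h3
  rw [h2]
  refine h1.trans ?_
  rw [shiftSchwartz_apply]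
  exact h3.symm

theorem inner_schwartzL2 (f g : 𝓢(ℝ, ℂ)) :
    ⟪schwartzL2 f, schwartzL2 g⟫_ℂ = ∫ t, conj (f t) * g t := by
  refine (SchwartzMap.inner_toL2_toL2_eq f g volume).trans ?_
  simp [mul_comm]

/-- The short-time Fourier transform `V_g f (w) = ⟨f, π(w) g⟩`. -/
def stft (g f : 𝓢(ℝ, ℂ)) (w : ℝ × ℝ) : ℂ := ⟪tfShift w (schwartzL2 g), schwartzL2 f⟫_ℂ

theorem stft_eq (g f : 𝓢(ℝ, ℂ)) (w : ℝ × ℝ) :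
    stft g f w = ∫ t, expi (-(t * w.2)) * (conj (g (t - w.1)) * f t) := by
  rw [stft, ← schwartzL2_shiftSchwartz, inner_schwartzL2]
  refine integral_congr_ae (Filter.Eventually.of_forall fun t => ?_)
  simp only [shiftSchwartz_apply, map_mul]
  have h := star_expi (t * w.2)
  rw [← h, mul_assoc]
  rfl

theorem norm_stft_le (g f : 𝓢(ℝ, ℂ)) (w : ℝ × ℝ) :
    ‖stft g f w‖ ≤ ∫ t, ‖g (t - w.1)‖ * ‖f t‖ := by
  rw [stft_eq]
  refine (norm_integral_le_integral_norm _).trans_eq ?_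
  refine integral_congr_ae (Filter.Eventually.of_forall fun t => ?_)
  simp [norm_expi]

theorem integrable_norm_shift_mul (g f : 𝓢(ℝ, ℂ)) (x : ℝ) :
    Integrable fun t => ‖g (t - x)‖ * ‖f t‖ := by
  refine (f.integrable.norm.const_mul (SchwartzMap.seminorm ℝ 0 0 g)).mono'
    (by fun_prop) (Filter.Eventually.of_forall fun t => ?_)
  rw [Real.norm_of_nonneg (by positivity)]
  exact mul_le_mul_of_nonneg_right (g.norm_le_seminorm ℝ _) (norm_nonneg _)

/-- Since |x| ≤ |t| + |t - x|, the power of x is absorbed by the decay of f or by that of g. -/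
theorem exists_integral_norm_shift_mul_le (g f : 𝓢(ℝ, ℂ)) (n : ℕ) :
    ∃ C : ℝ, 0 ≤ C ∧ ∀ x : ℝ, |x| ^ n * ∫ t, ‖g (t - x)‖ * ‖f t‖ ≤ C := by
  have hf : Integrable fun t => ‖f t‖ := f.integrable.norm
  have hfn : Integrable fun t : ℝ => ‖t‖ ^ n * ‖f t‖ := f.integrable_pow_mul _ n
  set p := SchwartzMap.seminorm ℝ 0 0 g
  set q := SchwartzMap.seminorm ℝ n 0 g
  have hp : 0 ≤ p := apply_nonneg _ _
  have hq : 0 ≤ q := apply_nonneg _ _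
  refine ⟨∫ t, 2 ^ (n - 1) * (p * (‖t‖ ^ n * ‖f t‖) + q * ‖f t‖),
    integral_nonneg fun t => by positivity, fun x => ?_⟩
  rw [← integral_const_mul]
  refine integral_mono ((integrable_norm_shift_mul g f x).const_mul _)
    (((hfn.const_mul p).add (hf.const_mul q)).const_mul _) fun t => ?_
  have h1 : |x| ^ n ≤ 2 ^ (n - 1) * (‖t‖ ^ n + ‖t - x‖ ^ n) := by
    refine le_trans ?_ (add_pow_le (norm_nonneg _) (norm_nonneg _) n)
    gcongr
    rw [← Real.norm_eq_abs, show x = t - (t - x) by ring]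
    exact norm_sub_le _ _ |>.trans (by simp)
  have h2 : ‖g (t - x)‖ ≤ p := g.norm_le_seminorm ℝ _
  have h3 : ‖t - x‖ ^ n * ‖g (t - x)‖ ≤ q := g.norm_pow_mul_le_seminorm ℝ n _
  calc |x| ^ n * (‖g (t - x)‖ * ‖f t‖)
      ≤ (2 ^ (n - 1) * (‖t‖ ^ n + ‖t - x‖ ^ n)) * (‖g (t - x)‖ * ‖f t‖) := by gcongr
    _ = 2 ^ (n - 1) * (‖g (t - x)‖ * (‖t‖ ^ n * ‖f t‖) +
        (‖t - x‖ ^ n * ‖g (t - x)‖) * ‖f t‖) := by ring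
    _ ≤ _ := by gcongr

theorem fourier_apply_eq (f : 𝓢(ℝ, ℂ)) (s : ℝ) : 𝓕 f s = ∫ t, expi (-(t * s)) * f t := by
  rw [SchwartzMap.fourier_coe, Real.fourier_real_eq_integral_exp_smul]
  refine integral_congr_ae (Filter.Eventually.of_forall fun t => ?_)
  simp only [expi, smul_eq_mul]
  congr 2
  push_cast
  ring

theorem norm_fourier_shiftSchwartz (z : ℝ × ℝ) (g : 𝓢(ℝ, ℂ)) (s : ℝ) :
    ‖𝓕 (shiftSchwartz z g) s‖ = ‖𝓕 g (s - z.2)‖ := by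
  have h1 : 𝓕 (shiftSchwartz z g) s = expi (-(z.1 * (s - z.2))) * 𝓕 g (s - z.2) := by
    rw [fourier_apply_eq, fourier_apply_eq, ← integral_const_mul,
      ← integral_sub_right_eq_self (fun t => expi (-(z.1 * (s - z.2))) *
        (expi (-(t * (s - z.2))) * g t)) z.1]
    refine integral_congr_ae (Filter.Eventually.of_forall fun t => ?_)
    simp only [shiftSchwartz_apply]
    rw [← mul_assoc, ← mul_assoc, ← expi_add, ← expi_add]
    congr 2
    ring
  rw [h1, norm_mul, norm_expi, one_mul]

theorem inner_schwartzL2_fourier (f g : 𝓢(ℝ, ℂ)) :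
    ⟪schwartzL2 (𝓕 f), schwartzL2 (𝓕 g)⟫_ℂ = ⟪schwartzL2 f, schwartzL2 g⟫_ℂ :=
  SchwartzMap.inner_fourier_toL2_eq f g

/-- By Plancherel the modulation becomes a translation, so decay in frequency follows from the same
estimate as decay in time. -/
theorem norm_stft_le_fourier (g f : 𝓢(ℝ, ℂ)) (w : ℝ × ℝ) :
    ‖stft g f w‖ ≤ ∫ s, ‖𝓕 g (s - w.2)‖ * ‖𝓕 f s‖ := by
  rw [stft, ← schwartzL2_shiftSchwartz, ← inner_schwartzL2_fourier, inner_schwartzL2]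
  refine (norm_integral_le_integral_norm _).trans_eq ?_
  refine integral_congr_ae (Filter.Eventually.of_forall fun t => ?_)
  simp [norm_fourier_shiftSchwartz]

/-- The short-time Fourier transform of Schwartz functions decays rapidly. -/
theorem exists_norm_stft_mul_le (g f : 𝓢(ℝ, ℂ)) (n : ℕ) :
    ∃ C : ℝ, ∀ w : ℝ × ℝ, ‖stft g f w‖ * √(w.1 ^ 2 + w.2 ^ 2) ^ n ≤ C := by
  obtain ⟨C, -, hC⟩ := exists_integral_norm_shift_mul_le g f n
  obtain ⟨D, -, hD⟩ := exists_integral_norm_shift_mul_le (𝓕 g) (𝓕 f) n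
  refine ⟨2 ^ (n - 1) * (C + D), fun w => ?_⟩
  have h1 : √(w.1 ^ 2 + w.2 ^ 2) ≤ |w.1| + |w.2| := by
    rw [Real.sqrt_le_left (by positivity), ← sq_abs w.1, ← sq_abs w.2]
    nlinarith [abs_nonneg w.1, abs_nonneg w.2]
  calc _ ≤ ‖stft g f w‖ * (2 ^ (n - 1) * (|w.1| ^ n + |w.2| ^ n)) := by
        gcongr
        exact (pow_le_pow_left₀ (Real.sqrt_nonneg _) h1 n).trans
          (add_pow_le (abs_nonneg _) (abs_nonneg _) n)
    _ = 2 ^ (n - 1) * (|w.1| ^ n * ‖stft g f w‖ + |w.2| ^ n * ‖stft g f w‖) := by ring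
    _ ≤ _ := by
        gcongr
        · exact (mul_le_mul_of_nonneg_left (norm_stft_le g f w) (by positivity)).trans (hC w.1)
        · exact (mul_le_mul_of_nonneg_left (norm_stft_le_fourier g f w) (by positivity)).trans
            (hD w.2)

theorem exists_norm_stft_mul_weight_le (g f : 𝓢(ℝ, ℂ)) (s : ℝ≥0) :
    ∃ C : ℝ, ∀ w : ℝ × ℝ, ‖stft g f w‖ * weight s w ≤ C := by
  obtain ⟨n, hn⟩ := weight_le s
  obtain ⟨C₀, h₀⟩ := exists_norm_stft_mul_le g f 0
  obtain ⟨C₁, h₁⟩ := exists_norm_stft_mul_le g f n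
  refine ⟨2 ^ n * (C₀ + C₁), fun w => ?_⟩
  calc _ ≤ ‖stft g f w‖ * _ := mul_le_mul_of_nonneg_left (hn w) (norm_nonneg _)
    _ = 2 ^ n * (‖stft g f w‖ * √(w.1 ^ 2 + w.2 ^ 2) ^ 0 +
        ‖stft g f w‖ * √(w.1 ^ 2 + w.2 ^ 2) ^ n) := by ring
    _ ≤ _ := by
      gcongr
      · exact h₀ w
      · exact h₁ w

theorem continuous_stft (g f : 𝓢(ℝ, ℂ)) : Continuous (stft g f) := by
  have h : stft g f = fun w => ∫ t, expi (-(t * w.2)) * (conj (g (t - w.1)) * f t) :=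
    funext (stft_eq g f)
  rw [h]
  have he := continuous_expi
  refine continuous_of_dominated (bound := fun t => SchwartzMap.seminorm ℝ 0 0 g * ‖f t‖)
    (fun w => ?_) (fun w => Filter.Eventually.of_forall fun t => ?_)
    (f.integrable.norm.const_mul _) (Filter.Eventually.of_forall fun t => ?_)
  · refine Continuous.aestronglyMeasurable ?_
    exact (he.comp (by fun_prop)).mul ((Complex.continuous_conj.comp
      (g.continuous.comp (by fun_prop))).mul f.continuous)
  · rw [norm_mul, norm_mul, norm_expi, one_mul, RCLike.norm_conj]
    exact mul_le_mul_of_nonneg_right (g.norm_le_seminorm ℝ _) (norm_nonneg _)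
  · exact (he.comp (by fun_prop)).mul ((Complex.continuous_conj.comp
      (g.continuous.comp (by fun_prop))).mul continuous_const)

theorem exists_norm_stft_mul_stft_le (g f g' f' : 𝓢(ℝ, ℂ)) :
    ∃ C : ℝ, ∀ w : ℝ × ℝ, ‖conj (stft g' f' w) * stft g f w‖ ≤ C * (weight 3 w)⁻¹ := by
  obtain ⟨C, hC⟩ := exists_norm_stft_mul_weight_le g f 3
  obtain ⟨D, hD⟩ := exists_norm_stft_mul_weight_le g' f' 0
  refine ⟨D * C, fun w => ?_⟩
  rw [← div_eq_mul_inv, le_div_iff₀ (weight_pos _ _), norm_mul, RCLike.norm_conj, mul_assoc]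
  have h1 : ‖stft g' f' w‖ ≤ D := by simpa [weight] using hD w
  exact mul_le_mul h1 (hC w) (mul_nonneg (norm_nonneg _) (weight_pos _ _).le)
    ((norm_nonneg _).trans h1)

/-- The Schwartz function `t ↦ conj (g (t - x)) f(t)`. -/
def windowed (g f : 𝓢(ℝ, ℂ)) (x : ℝ) : 𝓢(ℝ, ℂ) :=
  SchwartzMap.pairing (ContinuousLinearMap.mul ℝ ℂ)
    (SchwartzMap.postcompCLM (𝕜 := ℝ) (Complex.conjCLE : ℂ →L[ℝ] ℂ)
      (SchwartzMap.compSubConstCLM ℝ x g)) f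

theorem windowed_apply (g f : 𝓢(ℝ, ℂ)) (x t : ℝ) :
    windowed g f x t = conj (g (t - x)) * f t := by
  simp [windowed, SchwartzMap.pairing_apply_apply]

theorem stft_eq_fourier (g f : 𝓢(ℝ, ℂ)) (w : ℝ × ℝ) :
    stft g f w = 𝓕 (windowed g f w.1) w.2 := by
  rw [stft_eq, fourier_apply_eq]
  simp only [windowed_apply]

/-- The orthogonality relations for the short-time Fourier transform. -/
theorem integral_conj_stft_mul_stft (g f g' f' : 𝓢(ℝ, ℂ)) :
    ∫ w, conj (stft g' f' w) * stft g f w =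
      ⟪schwartzL2 f', schwartzL2 f⟫_ℂ * ⟪schwartzL2 g, schwartzL2 g'⟫_ℂ := by
  have hint : Integrable fun w => conj (stft g' f' w) * stft g f w := by
    obtain ⟨C, hC⟩ := exists_norm_stft_mul_stft_le g f g' f'
    exact (integrable_inv_weight.const_mul C).mono'
      ((Complex.continuous_conj.comp (continuous_stft g' f')).mul
        (continuous_stft g f)).aestronglyMeasurable (Filter.Eventually.of_forall hC)
  let A : ℝ → ℂ := fun t => conj (f' t) * f t
  let B : ℝ → ℂ := fun t => conj (g (-t)) * g' (-t)
  have hprod : ∀ f f' : 𝓢(ℝ, ℂ), Integrable fun t => conj (f' t) * f t := by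
    intro f f'
    refine (f.integrable.norm.const_mul (SchwartzMap.seminorm ℝ 0 0 f')).mono'
      ((Complex.continuous_conj.comp f'.continuous).mul f.continuous).aestronglyMeasurable
      (Filter.Eventually.of_forall fun t => ?_)
    rw [norm_mul, RCLike.norm_conj]
    exact mul_le_mul_of_nonneg_right (f'.norm_le_seminorm ℝ _) (norm_nonneg _)
  have hA : Integrable A := hprod f f'
  have hB : Integrable B := (hprod g' g).comp_neg
  -- For fixed x, Plancherel in ω leaves an integral over t. The reflection in B makes it a
  -- convolution at x, whose integral over x factors.
  have hinner : ∀ x : ℝ, ∫ ω, conj (stft g' f' (x, ω)) * stft g f (x, ω) =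
      (A ⋆[ContinuousLinearMap.mul ℂ ℂ, volume] B) x := by
    intro x
    simp only [stft_eq_fourier]
    rw [← inner_schwartzL2, inner_schwartzL2_fourier, inner_schwartzL2, convolution_def]
    refine integral_congr_ae (Filter.Eventually.of_forall fun t => ?_)
    simp only [windowed_apply, A, B, ContinuousLinearMap.mul_apply', neg_sub, map_mul,
      Complex.conj_conj]
    ring
  rw [Measure.volume_eq_prod, integral_prod _ hint]
  simp only [hinner]
  rw [integral_convolution _ hA hB, ContinuousLinearMap.mul_apply', inner_schwartzL2,
    inner_schwartzL2]
  congr 1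
  exact integral_neg_eq_self (fun t => conj (g t) * g' t) volume

end Schwartz

/-! ### Janssen's representation and the frame criterion -/

section Frame

variable (Λ : Submodule ℤ (ℝ × ℝ)) [DiscreteTopology Λ] [IsZLattice ℝ Λ] (g : 𝓢(ℝ, ℂ))

theorem stft_shiftSchwartz (f : 𝓢(ℝ, ℂ)) (w z : ℝ × ℝ) :
    stft (shiftSchwartz z g) (shiftSchwartz z f) w = expi (-sympl w z) * stft g f w := by
  have h1 : tfShift w (tfShift z (schwartzL2 g)) =
      expi (sympl w z) • tfShift z (tfShift w (schwartzL2 g)) :=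
    congrArg (fun T : L2R →L[ℂ] L2R => T (schwartzL2 g)) (tfShift_mul_comm w z)
  have h2 : ⟪tfShift z (tfShift w (schwartzL2 g)), tfShift z (schwartzL2 f)⟫_ℂ =
      ⟪tfShift w (schwartzL2 g), schwartzL2 f⟫_ℂ := (tfShiftIsom z).inner_map_map _ _
  rw [stft, schwartzL2_shiftSchwartz, schwartzL2_shiftSchwartz, h1, inner_smul_left, h2, stft,
    ← star_expi]
  rfl

/-- Shifting both f and g by z changes V_g f only by the phase e^{-2πi[w,z]}. The symplectic Fourier
transform of |V_g f|² is thus an instance of the orthogonality relations. -/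
theorem integral_expi_mul_stft (f : 𝓢(ℝ, ℂ)) (z : ℝ × ℝ) :
    ∫ w, expi (sympl w z) * (conj (stft g f w) * stft g f w) =
      ⟪tfShift z (schwartzL2 f), schwartzL2 f⟫_ℂ *
        ⟪schwartzL2 g, tfShift z (schwartzL2 g)⟫_ℂ := by
  rw [← schwartzL2_shiftSchwartz, ← schwartzL2_shiftSchwartz, ← integral_conj_stft_mul_stft]
  refine integral_congr_ae (Filter.Eventually.of_forall fun w => ?_)
  have h : conj (expi (-sympl w z)) = expi (sympl w z) :=
    (star_expi _).trans (by rw [neg_neg])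
  simp only [stft_shiftSchwartz, map_mul, h, mul_assoc]

/-- ⟨g,g⟩_B is the adjoint of Σ V_g g(z) π(z), whose coefficients decay rapidly. -/
theorem summable_and_innerB_mem :
    Summable (innerBTerm Λ.toAddSubgroup g g) ∧
      innerB Λ.toAddSubgroup g g ∈ smoothTorus (dualLattice Λ.toAddSubgroup) := by
  set Γ := dualLattice Λ.toAddSubgroup
  let b : Γ → ℂ := fun z => stft g g z
  have hsum := summable_mul_weight (summable_inv_weight_dualLattice Λ) (b := b) fun n => by
    obtain ⟨C, hC⟩ := exists_norm_stft_mul_le g g n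
    exact ⟨C, fun z => hC z⟩
  have hsum0 : Summable fun z => ‖b z‖ := by simpa [weight] using hsum 0
  obtain ⟨X, hX⟩ := summable_smul_tfShift hsum0
  have hterm : HasSum (innerBTerm Λ.toAddSubgroup g g) (star X) := by
    convert hX.star using 2 with z
    rw [star_smul, innerBTerm]
    congr 1
    exact (inner_conj_symm _ _).symm
  have hmem : X ∈ smoothTorus Γ := mem_smoothTorus_iff.2 fun s => ⟨b, hsum s, hX⟩
  refine ⟨hterm.summable, ?_⟩
  rw [innerB, hterm.tsum_eq]
  exact star_mem hmem

theorem hasSum_inner_innerB (f : L2R) :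
    HasSum (fun z : dualLattice Λ.toAddSubgroup =>
      ⟪tfShift z f, f⟫_ℂ * ⟪schwartzL2 g, tfShift z (schwartzL2 g)⟫_ℂ)
      ⟪f, innerB Λ.toAddSubgroup g g f⟫_ℂ := by
  have h := (summable_and_innerB_mem Λ g).1.hasSum
  have h2 := (h.mapL (ContinuousLinearMap.apply ℂ L2R f)).mapL (innerSL ℂ f)
  refine h2.congr_fun fun z => ?_
  change _ = ⟪f, (innerBTerm Λ.toAddSubgroup g g z) f⟫_ℂ
  rw [innerBTerm, smul_apply, inner_smul_right, ContinuousLinearMap.star_eq_adjoint,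
    ContinuousLinearMap.adjoint_inner_right, mul_comm]

theorem exists_tsum_stft_eq :
    ∃ c : ℝ, 0 < c ∧ ∀ f : 𝓢(ℝ, ℂ),
      HasSum (fun l : Λ.toAddSubgroup => ‖⟪tfShift l (schwartzL2 g), schwartzL2 f⟫_ℂ‖ ^ 2)
        (c * (⟪schwartzL2 f, innerB Λ.toAddSubgroup g g (schwartzL2 f)⟫_ℂ).re) := by
  obtain ⟨c, hc, h⟩ := exists_tsum_eq_mul_tsum_integral Λ
  refine ⟨c, hc, fun f => ?_⟩
  have hS := hasSum_inner_innerB Λ g (schwartzL2 f)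
  have hbd := exists_norm_stft_mul_stft_le g f g f
  have h1 := h (fun w => conj (stft g f w) * stft g f w)
    ((Complex.continuous_conj.comp (continuous_stft g f)).mul (continuous_stft g f))
    hbd (by simpa only [integral_expi_mul_stft] using hS.summable)
  simp only [integral_expi_mul_stft] at h1
  rw [hS.tsum_eq] at h1
  have hterm : ∀ w, conj (stft g f w) * stft g f w = ((‖stft g f w‖ ^ 2 : ℝ) : ℂ) := fun w => by
    rw [mul_comm, Complex.mul_conj']
    push_cast
    rfl
  have hsum : Summable fun l : Λ.toAddSubgroup => ‖stft g f l‖ ^ 2 := by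
    obtain ⟨A, hA⟩ := exists_linearEquiv Λ
    obtain ⟨C, hC⟩ := hbd
    have h2 : Summable fun l : Λ.toAddSubgroup => (weight 3 l)⁻¹ := by
      rw [← (latticeEquiv hA).summable_iff]
      exact summable_inv_weight_linearEquiv A
    refine (h2.mul_left C).of_nonneg_of_le (fun l => by positivity) fun l => ?_
    refine le_trans (le_of_eq ?_) (hC l)
    rw [hterm, Complex.norm_real, Real.norm_of_nonneg (by positivity)]
  simp only [hterm] at h1
  rw [← Complex.ofReal_tsum] at h1
  have h3 := congrArg Complex.re h1
  rw [Complex.ofReal_re, Complex.re_ofReal_mul] at h3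
  rw [← h3]
  exact hsum.hasSum

theorem denseRange_schwartzL2 : DenseRange schwartzL2 :=
  SchwartzMap.denseRange_toLpCLM (F := ℂ) (E := ℝ) (p := 2) (μ := volume) (by simp)

/-- Janssen's representation of the frame operator, as an identity of quadratic forms. -/
theorem exists_hasSum_norm_inner_sq :
    ∃ c : ℝ, 0 < c ∧ ∀ f : L2R,
      HasSum (fun l : Λ.toAddSubgroup => ‖⟪tfShift l (schwartzL2 g), f⟫_ℂ‖ ^ 2)
        (c * (⟪f, innerB Λ.toAddSubgroup g g f⟫_ℂ).re) := by
  obtain ⟨c, hc, h⟩ := exists_tsum_stft_eq Λ g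
  refine ⟨c, hc, ?_⟩
  set T := innerB Λ.toAddSubgroup g g
  let q : L2R → ℝ := fun f => c * (⟪f, T f⟫_ℂ).re
  have hq : Continuous q := by fun_prop
  let v : Λ.toAddSubgroup → L2R := fun l => tfShift l (schwartzL2 g)
  -- Finite partial sums are continuous in f, so their bound by q passes from Schwartz functions to
  -- L². This yields the Bessel property, hence a bounded analysis operator into ℓ²; only then is
  -- the full sum continuous and the identity extends by density.
  have hle : ∀ (s : Finset Λ.toAddSubgroup) (f : L2R), ∑ l ∈ s, ‖⟪v l, f⟫_ℂ‖ ^ 2 ≤ q f := by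
    intro s f
    refine denseRange_schwartzL2.induction_on f (isClosed_le (by fun_prop) hq) fun f => ?_
    exact sum_le_hasSum s (fun _ _ => by positivity) (h f)
  have hsum : ∀ f : L2R, Summable fun l => ‖⟪v l, f⟫_ℂ‖ ^ 2 := fun f =>
    summable_of_sum_le (fun _ => by positivity) fun s => hle s f
  have hqle : ∀ f, q f ≤ c * ‖T‖ * ‖f‖ ^ 2 := fun f => by
    have h1 : (⟪f, T f⟫_ℂ).re ≤ ‖f‖ * (‖T‖ * ‖f‖) :=
      (Complex.re_le_norm _).trans ((norm_inner_le_norm _ _).trans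
        (mul_le_mul_of_nonneg_left (T.le_opNorm f) (norm_nonneg _)))
    calc q f ≤ c * (‖f‖ * (‖T‖ * ‖f‖)) := mul_le_mul_of_nonneg_left h1 hc.le
      _ = _ := by ring
  have hmem : ∀ f : L2R, Memℓp (fun l => ⟪v l, f⟫_ℂ) 2 := fun f => by
    refine memℓp_gen ?_
    simpa using hsum f
  let C₀ : L2R →ₗ[ℂ] lp (fun _ : Λ.toAddSubgroup => ℂ) 2 :=
    { toFun := fun f => ⟨fun l => ⟪v l, f⟫_ℂ, hmem f⟩
      map_add' := fun f f' => by
        ext l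
        exact inner_add_right _ _ _
      map_smul' := fun a f => by
        ext l
        exact inner_smul_right _ _ _ }
  have hnorm : ∀ f, ‖C₀ f‖ ^ 2 = ∑' l, ‖⟪v l, f⟫_ℂ‖ ^ 2 := fun f => by
    have h1 := lp.norm_rpow_eq_tsum (p := 2) (by norm_num) (C₀ f)
    simp only [ENNReal.toReal_ofNat, Real.rpow_ofNat] at h1
    exact h1
  have hbound : ∀ f, ‖C₀ f‖ ≤ √(c * ‖T‖) * ‖f‖ := fun f => by
    refine (pow_le_pow_iff_left₀ (norm_nonneg _) (by positivity) two_ne_zero).1 ?_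
    rw [hnorm, mul_pow, Real.sq_sqrt (by positivity)]
    exact ((hsum f).tsum_le_of_sum_le fun s => hle s f).trans (hqle f)
  let C := C₀.mkContinuous _ hbound
  have hCc : Continuous fun f => ‖C₀ f‖ ^ 2 := (C.continuous.norm).pow 2
  have heq : ∀ f, ‖C₀ f‖ ^ 2 = q f := fun f =>
    denseRange_schwartzL2.induction_on f (isClosed_eq hCc hq) fun f => by
      rw [hnorm]
      exact (h f).tsum_eq
  intro f
  have h2 := (hsum f).hasSum
  rw [← hnorm, heq] at h2
  exact h2

/-- The adjoint of the term at z is the term at -z: both carry the same phase. -/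
theorem star_innerB :
    star (innerB Λ.toAddSubgroup g g) = innerB Λ.toAddSubgroup g g := by
  have hs := (summable_and_innerB_mem Λ g).1.hasSum
  have h1 := hs.star
  have h2 := (Equiv.neg (dualLattice Λ.toAddSubgroup)).hasSum_iff.2 hs
  refine h1.unique (h2.congr_fun fun z => ?_)
  have h3 : star ⟪schwartzL2 g, tfShift z (schwartzL2 g)⟫_ℂ =
      ⟪schwartzL2 g, star (tfShift (z : ℝ × ℝ)) (schwartzL2 g)⟫_ℂ := by
    rw [ContinuousLinearMap.star_eq_adjoint, ContinuousLinearMap.adjoint_inner_right]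
    exact inner_conj_symm _ _
  have h4 : innerBTerm Λ.toAddSubgroup g g (-z) =
      ⟪schwartzL2 g, tfShift (-(z : ℝ × ℝ)) (schwartzL2 g)⟫_ℂ •
        star (tfShift (-(z : ℝ × ℝ))) := rfl
  change star (innerBTerm _ g g z) = innerBTerm _ g g (-z)
  rw [h4, innerBTerm, star_smul, star_star, h3, star_tfShift, star_tfShift, smul_apply,
    inner_smul_right, smul_smul, neg_neg, Prod.fst_neg, Prod.snd_neg, neg_mul_neg, mul_comm]

/-- A positive invertible operator is bounded below. -/
theorem exists_le_re_inner_of_isUnit {T : L2R →L[ℂ] L2R} (hT : IsUnit T) (hsa : star T = T)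
    (hpos : ∀ f, 0 ≤ (⟪f, T f⟫_ℂ).re) :
    ∃ α : ℝ, 0 < α ∧ ∀ f, α * ‖f‖ ^ 2 ≤ (⟪f, T f⟫_ℂ).re := by
  obtain ⟨Y, hYT⟩ := hT.exists_left_inv
  set t : ℝ := (‖T‖ + 1)⁻¹ with ht
  have ht0 : 0 < t := by positivity
  have htT : t * ‖T‖ ≤ 1 := by
    rw [ht, inv_mul_le_iff₀ (by positivity)]
    linarith
  have hadj : ∀ x y : L2R, ⟪x, T y⟫_ℂ = ⟪T x, y⟫_ℂ := fun x y => by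
    rw [← ContinuousLinearMap.adjoint_inner_right, ← ContinuousLinearMap.star_eq_adjoint, hsa]
  refine ⟨t / (‖Y‖ + 1) ^ 2, by positivity, fun f => ?_⟩
  have h1 : t * ‖T f‖ ^ 2 ≤ (⟪f, T f⟫_ℂ).re := by
    -- Positivity at f - tTf gives 2t‖Tf‖² ≤ ⟨f,Tf⟩ + t²⟨Tf,T²f⟩. As t‖T‖ ≤ 1, the last term is at
    -- most t‖Tf‖².
    have h2 := hpos (f - (t : ℂ) • T f)
    have h3 : (⟪T f, T (T f)⟫_ℂ).re ≤ ‖T‖ * ‖T f‖ ^ 2 :=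
      (Complex.re_le_norm _).trans ((norm_inner_le_norm _ _).trans
        ((mul_le_mul_of_nonneg_left (T.le_opNorm (T f)) (norm_nonneg _)).trans_eq (by ring)))
    have h4 : (⟪T f, T f⟫_ℂ).re = ‖T f‖ ^ 2 := by
      rw [inner_self_eq_norm_sq_to_K]
      norm_cast
    have h5 : (⟪f - (t : ℂ) • T f, T (f - (t : ℂ) • T f)⟫_ℂ).re =
        (⟪f, T f⟫_ℂ).re - 2 * t * ‖T f‖ ^ 2 + t ^ 2 * (⟪T f, T (T f)⟫_ℂ).re := by
      rw [map_sub, map_smul, inner_sub_left, inner_sub_right, inner_sub_right, inner_smul_left,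
        inner_smul_left, inner_smul_right, inner_smul_right, hadj f (T f), Complex.conj_ofReal]
      simp only [Complex.sub_re, Complex.re_ofReal_mul, h4]
      ring
    rw [h5] at h2
    have h6 : t ^ 2 * (⟪T f, T (T f)⟫_ℂ).re ≤ t * ‖T f‖ ^ 2 := by
      calc _ ≤ t ^ 2 * (‖T‖ * ‖T f‖ ^ 2) := by gcongr
        _ = (t * ‖T‖) * (t * ‖T f‖ ^ 2) := by ring
        _ ≤ 1 * (t * ‖T f‖ ^ 2) := by gcongr
        _ = _ := one_mul _
    linarith
  refine le_trans ?_ h1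
  rw [div_mul_eq_mul_div, div_le_iff₀ (by positivity), mul_assoc]
  refine mul_le_mul_of_nonneg_left ?_ ht0.le
  rw [← mul_pow]
  refine pow_le_pow_left₀ (norm_nonneg _) ?_ 2
  have h7 : Y (T f) = f := congrArg (fun X : L2R →L[ℂ] L2R => X f) hYT
  have h8 := Y.le_opNorm (T f)
  rw [h7] at h8
  nlinarith [norm_nonneg (T f)]

/-- Up to the factor c, the lower frame bound is coercivity of ⟨g,g⟩_B; the upper one comes from its
norm, with 1 added to make β positive. -/
theorem isGaborFrame_iff_isUnit : IsGaborFrame Λ.toAddSubgroup (schwartzL2 g) ↔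
    IsUnit (innerB Λ.toAddSubgroup g g) := by
  obtain ⟨c, hc, h⟩ := exists_hasSum_norm_inner_sq Λ g
  constructor
  · rintro ⟨α, hα, β, -, hf⟩
    refine ContinuousLinearMap.isUnit_of_forall_le_norm_inner_map _
      (c := (α / c).toNNReal) (Real.toNNReal_pos.2 (div_pos hα hc)) fun f => ?_
    have h1 := (hf f).2.1
    rw [(h f).tsum_eq] at h1
    rw [norm_inner_symm, Real.coe_toNNReal _ (div_pos hα hc).le, mul_div_assoc', div_le_iff₀ hc]
    have h2 := mul_le_mul_of_nonneg_left
      (Complex.re_le_norm (⟪f, innerB Λ.toAddSubgroup g g f⟫_ℂ)) hc.le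
    linarith
  · intro hu
    have hpos : ∀ f, 0 ≤ (⟪f, innerB Λ.toAddSubgroup g g f⟫_ℂ).re := fun f =>
      nonneg_of_mul_nonneg_right ((h f).nonneg fun l => by positivity) hc
    obtain ⟨α, hα, hαf⟩ := exists_le_re_inner_of_isUnit hu (star_innerB Λ g) hpos
    refine ⟨c * α, by positivity, c * (‖innerB Λ.toAddSubgroup g g‖ + 1), by positivity,
      fun f => ⟨(h f).summable, ?_⟩⟩
    rw [(h f).tsum_eq]
    constructor
    · rw [mul_assoc]
      exact mul_le_mul_of_nonneg_left (hαf f) hc.le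
    · rw [mul_assoc]
      refine mul_le_mul_of_nonneg_left ?_ hc.le
      refine (Complex.re_le_norm _).trans ((norm_inner_le_norm _ _).trans ?_)
      have h1 := ContinuousLinearMap.le_opNorm (innerB Λ.toAddSubgroup g g) f
      nlinarith [norm_nonneg f]

/-- Spectral invariance: an inverse in B(L²) already lies in the smooth torus. -/
theorem isUnit_mk_iff {T : L2R →L[ℂ] L2R} (hT : T ∈ smoothTorus (dualLattice Λ.toAddSubgroup)) :
    IsUnit (⟨T, hT⟩ : smoothTorus (dualLattice Λ.toAddSubgroup)) ↔ IsUnit T := by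
  constructor
  · intro h
    exact h.map (smoothTorus (dualLattice Λ.toAddSubgroup)).subtype
  · rintro ⟨u, rfl⟩
    have hY := inverse_mem_smoothTorus (summable_inv_weight_dualLattice Λ) hT u.mul_inv u.inv_mul
    exact ⟨⟨⟨u, hT⟩, ⟨_, hY⟩, Subtype.ext u.mul_inv, Subtype.ext u.inv_mul⟩, rfl⟩

end Frame

end GaborTorus

end

theorem mainTheorem5 (Λ : Submodule ℤ (ℝ × ℝ)) [DiscreteTopology Λ] [IsZLattice ℝ Λ]
    (g : SchwartzMap ℝ ℂ) :
    Summable (GaborTorus.innerBTerm Λ.toAddSubgroup g g) ∧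
    ∃ h : GaborTorus.innerB Λ.toAddSubgroup g g ∈
        GaborTorus.smoothTorus (GaborTorus.dualLattice Λ.toAddSubgroup),
      (GaborTorus.IsGaborFrame Λ.toAddSubgroup (GaborTorus.schwartzL2 g) ↔
        IsUnit (⟨GaborTorus.innerB Λ.toAddSubgroup g g, h⟩ :
          GaborTorus.smoothTorus (GaborTorus.dualLattice Λ.toAddSubgroup))) := by
  obtain ⟨hs, hm⟩ := GaborTorus.summable_and_innerB_mem Λ g
  exact ⟨hs, hm, (GaborTorus.isGaborFrame_iff_isUnit Λ g).trans
    (GaborTorus.isUnit_mk_iff Λ hm).symm⟩
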